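/- Let $u_1,\dots,u_n$ be vectors that span $\mathbb{R}^d$, and let $$\Omega_n = \Big\{ \sum_{j=1}^{n} t_j u_j \;:\; t_1,\dots,t_n \in [-\tfrac12, \tfrac12] \Big\} \subset \mathbb{R}^d$$ be the origin-symmetric zonotope that they generate. Then there is a set $\Lambda_n \subset \mathbb{R}^d$ such that the system of exponential functions $E(\Lambda_n) = \{e_\lambda\}_{\lambda \in \Lambda_n}$, $e_\lambda(x) = e^{2\pi i \langle \lambda, x\rangle}$, is a Riesz basis in $L^2(\Omega_n)$ (with Lebesgue measure), that is, it is the image of an orthonormal basis of $L^2(\Omega_n)$ under a bounded and invertible linear map from $L^2(\Omega_n)$ onto itself. -/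

import Mathlib

noncomputable section

/-- A system `f` in a Hilbert space `H` is a Riesz basis if it is the image of an orthonormal
basis of `H` under a bounded and invertible linear map of `H`. -/
def IsRieszBasis {H : Type*} [NormedAddCommGroup H] [InnerProductSpace ℂ H] {ι : Type*}
    (f : ι → H) : Prop :=
  ∃ (b : HilbertBasis ι ℂ H) (T : H ≃L[ℂ] H), ∀ i, f i = T (b i)

/-- The exponential function `x ↦ exp (2πi⟨l, x⟩)` with frequency `l`. -/
def expFun {d : ℕ} (l x : EuclideanSpace ℝ (Fin d)) : ℂ :=
  Complex.exp (2 * Real.pi * Complex.I * (inner ℝ l x : ℝ))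

/-- The system of exponentials with frequencies in `L` (each `l ∈ L` taken once) is a Riesz basis
in `L²(S)`, the space of complex-valued square integrable functions on `S` with respect to
Lebesgue measure. -/
def IsExpRieszBasis {d : ℕ} (S L : Set (EuclideanSpace ℝ (Fin d))) : Prop :=
  ∃ f : L → MeasureTheory.Lp ℂ 2 (MeasureTheory.volume.restrict S),
    (∀ l : L, f l =ᵐ[MeasureTheory.volume.restrict S] expFun (l : EuclideanSpace ℝ (Fin d))) ∧
      IsRieszBasis f

/-- The origin-symmetric zonotope generated by the vectors `u j`. -/
def zonotope {d n : ℕ} (u : Fin n → EuclideanSpace ℝ (Fin d)) :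
    Set (EuclideanSpace ℝ (Fin d)) :=
  {x | ∃ t : Fin n → ℝ, (∀ j, t j ∈ Set.Icc (-(1 / 2) : ℝ) (1 / 2)) ∧ x = ∑ j, t j • u j}

end

/-! The proof is an induction on the number of generators, for arbitrary families in arbitrary
finite-dimensional spaces. If the last generator vanishes, it is dropped. Otherwise coordinates are
chosen in which it is e = (0, 1) in `F × ℝ`. The zonotope is then Ω = C + [-1/2, 1/2]e, where C is
the zonotope of the other generators. The projection P of C to `F` is a zonotope too, so the
induction hypothesis gives exponential Riesz bases on both C and P.

These two bases are joined by the difference operator D f(z) = f(z - e/2) - f(z + e/2) from L²(Ω) to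
L²(C). Each vertical line over P meets Ω in an interval of length at least 1, and if z and z + e lie
in Ω then z + e/2 lies in C. Hence ker D consists of the restrictions of functions 1-periodic in the
vertical direction, a copy of L²(P × ℝ/ℤ). Products of the basis on P with the characters of ℝ/ℤ
form a Riesz basis there. On the other side, D multiplies the exponential of frequency l by -2i
sin(π l(e)). If the numbers l(e) stay away from the integers, D carries the exponentials of the
basis on C, now viewed on Ω, to a Riesz basis of L²(C). The union of the two systems is then a Riesz
basis of L²(Ω) (`IsRiesz.thicken`).

To keep l(e) away from the integers, the offending frequencies are moved by a small multiple of the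
vertical coordinate. This preserves the Riesz property on the bounded set C (`IsRiesz.perturb`). The
exponentials from C must also have a bounded synthesis operator on the larger set Ω, so the
induction carries the Bessel property on every ball. -/

noncomputable section

open MeasureTheory Set Filter
open scoped ENNReal NNReal Topology

/-! ### Polar decomposition and operators on ℓ² -/

/-- Every isomorphism of Hilbert spaces is a unitary map followed by an automorphism. -/
theorem exists_polar_decomposition {K H : Type*} [NormedAddCommGroup K] [InnerProductSpace ℂ K]
    [CompleteSpace K] [NormedAddCommGroup H] [InnerProductSpace ℂ H] [CompleteSpace H]
    (T : K ≃L[ℂ] H) : ∃ (U : K ≃ₗᵢ[ℂ] H) (S : H ≃L[ℂ] H), ∀ x, T x = S (U x) := by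
  set T' : K →L[ℂ] H := T.toContinuousLinearMap with hT'
  set A : K →L[ℂ] K := ContinuousLinearMap.adjoint T' ∘L T' with hA
  have hpos : 0 ≤ A := by
    rw [ContinuousLinearMap.nonneg_iff_isPositive]
    exact ContinuousLinearMap.isPositive_adjoint_comp_self T'
  have hunit : IsUnit A := by
    set S' : H →L[ℂ] K := T.symm.toContinuousLinearMap
    have h1 : T' ∘L S' = 1 := by ext x; simp [T', S']
    have h2 : S' ∘L T' = 1 := by ext x; simp [T', S']
    refine ⟨⟨A, S' ∘L ContinuousLinearMap.adjoint S', ?_, ?_⟩, rfl⟩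
    · change (ContinuousLinearMap.adjoint T' ∘L T') ∘L (S' ∘L ContinuousLinearMap.adjoint S') = 1
      rw [ContinuousLinearMap.comp_assoc, ← ContinuousLinearMap.comp_assoc T', h1]
      change ContinuousLinearMap.adjoint T' ∘L ContinuousLinearMap.adjoint S' = 1
      rw [← ContinuousLinearMap.adjoint_comp, h2]
      exact ContinuousLinearMap.adjoint_id
    · change (S' ∘L ContinuousLinearMap.adjoint S') ∘L (ContinuousLinearMap.adjoint T' ∘L T') = 1
      rw [ContinuousLinearMap.comp_assoc, ← ContinuousLinearMap.comp_assoc _ _ T',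
        ← ContinuousLinearMap.adjoint_comp, h1]
      rw [show ContinuousLinearMap.adjoint (1 : H →L[ℂ] H) = 1 from
        ContinuousLinearMap.adjoint_id]
      exact h2
  -- Q = (T*T)^(1/2) is the modulus of T. Since ‖Tx‖ = ‖Qx‖, the map U = TQ⁻¹ is unitary, and T = UQ
  -- = (UQU⁻¹)U.
  set Q := CFC.sqrt A
  have hQunit : IsUnit Q := (CFC.isUnit_sqrt_iff A).2 hunit
  have hQQ : Q * Q = A := CFC.sqrt_mul_sqrt_self A
  have hQsa : IsSelfAdjoint Q := (CFC.sqrt_nonneg A).isSelfAdjoint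
  set q : K ≃L[ℂ] K := ContinuousLinearEquiv.ofUnit hQunit.unit
  have hq : ∀ x, q x = Q x := fun x => rfl
  have hnorm : ∀ x, ‖T x‖ = ‖q x‖ := by
    intro x
    have h1 : inner ℂ (T' x) (T' x) = inner ℂ (Q x) (Q x) := by
      rw [← ContinuousLinearMap.adjoint_inner_right, ← ContinuousLinearMap.adjoint_inner_right Q]
      change inner ℂ x (A x) = _
      rw [← hQQ, show ContinuousLinearMap.adjoint Q = Q from hQsa]
      rfl
    rw [inner_self_eq_norm_sq_to_K, inner_self_eq_norm_sq_to_K] at h1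
    have h2 : ‖T x‖ ^ 2 = ‖q x‖ ^ 2 := by exact_mod_cast h1
    exact (sq_eq_sq₀ (norm_nonneg _) (norm_nonneg _)).1 h2
  let U : K ≃ₗᵢ[ℂ] H :=
    { (q.symm.trans T).toLinearEquiv with
      norm_map' := fun x => by
        change ‖T (q.symm x)‖ = ‖x‖
        rw [hnorm]; simp }
  have hU : ∀ x, T (q.symm x) = U x := fun x => rfl
  refine ⟨U, (U.symm.toContinuousLinearEquiv.trans q).trans U.toContinuousLinearEquiv,
    fun x => ?_⟩
  change T x = U (q (U.symm (U x)))
  rw [U.symm_apply_apply, ← hU, q.symm_apply_apply]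

/-- The Hilbert space of square summable families of complex numbers. -/
abbrev SeqL2 (ι : Type*) := lp (fun _ : ι => ℂ) 2

namespace SeqL2

variable {ι κ : Type*} {H : Type*} [NormedAddCommGroup H] [InnerProductSpace ℂ H]

open scoped Classical in
/-- The standard basis vectors of `SeqL2 ι`. -/
def delta (i : ι) : SeqL2 ι := lp.single 2 i 1

/-- The standard Hilbert basis of `SeqL2 ι`. -/
def stdBasis (ι : Type*) : HilbertBasis ι ℂ (SeqL2 ι) := ⟨LinearIsometryEquiv.refl ℂ _⟩

theorem stdBasis_apply (i : ι) : stdBasis ι i = delta i := by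
  classical
  rw [← HilbertBasis.repr_symm_single]
  simp only [stdBasis, delta]
  congr

theorem orthonormal_delta : Orthonormal ℂ (delta : ι → SeqL2 ι) := by
  have h := (stdBasis ι).orthonormal
  rwa [show ⇑(stdBasis ι) = delta from funext stdBasis_apply] at h

theorem clm_ext {F : Type*} [NormedAddCommGroup F] [NormedSpace ℂ F] {A B : SeqL2 ι →L[ℂ] F}
    (h : ∀ i, A (delta i) = B (delta i)) : A = B := by
  have hd := (stdBasis ι).dense_span
  refine ContinuousLinearMap.ext_on (s := Set.range (stdBasis ι)) ?_ ?_
  · rw [dense_iff_closure_eq, ← Submodule.topologicalClosure_coe, hd]; rfl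
  · rintro _ ⟨i, rfl⟩
    simpa [stdBasis_apply] using h i

theorem exists_diag (a : ι → ℂ) (K : ℝ≥0) (ha : ∀ i, ‖a i‖ ≤ K) :
    ∃ D : SeqL2 ι →L[ℂ] SeqL2 ι, ‖D‖ ≤ K ∧ ∀ i, D (delta i) = a i • delta i := by
  classical
  have hK : ∀ i, ‖a i • ContinuousLinearMap.id ℂ ℂ‖ ≤ K := fun i => by
    refine (norm_smul_le (a i) (ContinuousLinearMap.id ℂ ℂ)).trans ?_
    simpa using ha i
  refine ⟨lp.mapCLM 2 (fun i => a i • ContinuousLinearMap.id ℂ ℂ) K.2 hK,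
    lp.norm_mapCLM_le 2 _ K.2 hK, fun i => ?_⟩
  · ext j
    by_cases h : j = i
    · subst h; simp [delta, lp.mapCLM]
    · simp [delta, lp.mapCLM, lp.single_apply, Pi.single_apply, h]

theorem exists_isometry_of_orthonormal [CompleteSpace H] {v : ι → H} (hv : Orthonormal ℂ v) :
    ∃ J : SeqL2 ι →ₗᵢ[ℂ] H, ∀ i, J (delta i) = v i := by
  classical
  refine ⟨hv.orthogonalFamily.linearIsometry, fun i => ?_⟩
  simp only [delta]
  convert! hv.orthogonalFamily.linearIsometry_apply_single (1 : ℂ)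
  simp

theorem exists_extend (j : ι → κ) (hj : Function.Injective j) :
    ∃ J : SeqL2 ι →L[ℂ] SeqL2 κ, ∀ i, J (delta i) = delta (j i) := by
  obtain ⟨J, hJ⟩ := exists_isometry_of_orthonormal (orthonormal_delta.comp j hj)
  exact ⟨J.toContinuousLinearMap, hJ⟩

theorem eq_of_inner_delta {x y : SeqL2 ι} (h : ∀ i, inner ℂ (delta i) x = inner ℂ (delta i) y) :
    x = y := by
  apply (stdBasis ι).repr.injective
  ext i
  simpa [HilbertBasis.repr_apply_apply, stdBasis_apply] using h i

/-- The restriction is the adjoint of the isometric extension along `j`. -/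
theorem exists_restrict (j : ι → κ) (hj : Function.Injective j) :
    ∃ R : SeqL2 κ →L[ℂ] SeqL2 ι, (∀ i, R (delta (j i)) = delta i) ∧
      ∀ k, k ∉ Set.range j → R (delta k) = 0 := by
  classical
  obtain ⟨J, hJ⟩ := exists_extend j hj
  have hi := orthonormal_iff_ite.1 (orthonormal_delta (ι := ι))
  have hk := orthonormal_iff_ite.1 (orthonormal_delta (ι := κ))
  refine ⟨ContinuousLinearMap.adjoint J, fun i => eq_of_inner_delta fun i' => ?_,
    fun k h => eq_of_inner_delta fun i' => ?_⟩
  · rw [ContinuousLinearMap.adjoint_inner_right, hJ, hi, hk]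
    simp [hj.eq_iff]
  · rw [ContinuousLinearMap.adjoint_inner_right, hJ, hk, if_neg fun e => h ⟨i', e⟩]
    simp

theorem exists_reindex (e : ι ≃ κ) :
    ∃ J : SeqL2 ι ≃L[ℂ] SeqL2 κ, ∀ i, J (delta i) = delta (e i) := by
  obtain ⟨J, hJ⟩ := exists_extend e e.injective
  obtain ⟨R, hR⟩ := exists_extend e.symm e.symm.injective
  refine ⟨ContinuousLinearEquiv.equivOfInverse' J R (clm_ext fun i => ?_) (clm_ext fun i => ?_),
    hJ⟩ <;> simp [hJ, hR]

theorem delta_injective : Function.Injective (delta : ι → SeqL2 ι) :=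
  orthonormal_delta.linearIndependent.injective

/-- The image of the standard basis under an isomorphism is a Riesz basis. -/
theorem isRieszBasis_of_equiv [CompleteSpace H] (T : SeqL2 ι ≃L[ℂ] H) :
    IsRieszBasis fun i => T (delta i) := by
  obtain ⟨U, S, hUS⟩ := exists_polar_decomposition T
  refine ⟨⟨U.symm⟩, S, fun i => ?_⟩
  have : (⟨U.symm⟩ : HilbertBasis ι ℂ H) i = U (delta i) := by
    classical
    rw [← HilbertBasis.repr_symm_single]
    simp only [delta]
    congr
  rw [this, ← hUS]

end SeqL2

/-! ### Composition and multiplication operators on L² -/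

section LpOperators

variable {X Y : Type*} [MeasurableSpace X] [MeasurableSpace Y]

theorem MeasureTheory.MemLp.comp_of_map_le {m : Measure X} {m' : Measure Y} {φ : X → Y}
    (hφ : Measurable φ) {K : ℝ≥0∞} (hK : K ≠ ∞) (h : m.map φ ≤ K • m') {f : Y → ℂ}
    (hf : MemLp f 2 m') : MemLp (f ∘ φ) 2 m :=
  ((hf.smul_measure hK).mono_measure h).comp_of_map hφ.aemeasurable

theorem quasiMeasurePreserving_of_map_le {m : Measure X} {m' : Measure Y} {φ : X → Y}
    (hφ : Measurable φ) {K : ℝ≥0∞} (h : m.map φ ≤ K • m') :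
    Measure.QuasiMeasurePreserving φ m m' :=
  ⟨hφ, h.absolutelyContinuous.trans (Measure.smul_absolutelyContinuous)⟩

/-- Composition with a map whose push-forward measure is dominated is a bounded operator. -/
theorem exists_pullback {m : Measure X} {m' : Measure Y} {φ : X → Y}
    (hφ : Measurable φ) {K : ℝ≥0∞} (hK : K ≠ ∞) (h : m.map φ ≤ K • m') :
    ∃ P : Lp ℂ 2 m' →L[ℂ] Lp ℂ 2 m, ∀ f, P f =ᵐ[m] f ∘ φ := by
  have hq := quasiMeasurePreserving_of_map_le hφ h
  have hmem : ∀ f : Lp ℂ 2 m', MemLp (f ∘ φ) 2 m := fun f =>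
    (Lp.memLp f).comp_of_map_le hφ hK h
  let P₀ : Lp ℂ 2 m' →ₗ[ℂ] Lp ℂ 2 m :=
    { toFun := fun f => (hmem f).toLp
      map_add' := fun f g => by
        apply Lp.ext
        filter_upwards [(hmem (f + g)).coeFn_toLp, (hmem f).coeFn_toLp, (hmem g).coeFn_toLp,
          Lp.coeFn_add (hmem f).toLp (hmem g).toLp, hq.ae_eq_comp (Lp.coeFn_add f g)]
          with x h1 h2 h3 h4 h5
        rw [h1, h4, h5, Pi.add_apply, h2, h3]; rfl
      map_smul' := fun c f => by
        apply Lp.ext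
        filter_upwards [(hmem (c • f)).coeFn_toLp, (hmem f).coeFn_toLp,
          Lp.coeFn_smul c (hmem f).toLp, hq.ae_eq_comp (Lp.coeFn_smul c f)] with x h1 h2 h4 h5
        rw [h1, RingHom.id_apply, h4, h5, Pi.smul_apply, h2]; rfl }
  refine ⟨P₀.mkContinuous ((K ^ (1 / 2 : ℝ)).toReal) fun f => ?_, fun f => (hmem f).coeFn_toLp⟩
  change ‖(hmem f).toLp‖ ≤ _
  rw [Lp.norm_toLp, Lp.norm_def, ← ENNReal.toReal_mul]
  refine ENNReal.toReal_mono (ENNReal.mul_ne_top (by finiteness) (Lp.eLpNorm_ne_top f)) ?_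
  rw [← eLpNorm_map_measure _ hφ.aemeasurable]
  · refine (eLpNorm_mono_measure _ h).trans ?_
    rw [eLpNorm_smul_measure_of_ne_top (by simp)]
    simp
  · exact (((Lp.memLp f).smul_measure hK).mono_measure h).1

/-- Multiplication by a bounded function is a bounded operator. -/
theorem exists_mulOperator {m : Measure X} {w : X → ℂ} (hw : Measurable w) (K : ℝ≥0)
    (hK : ∀ᵐ x ∂m, ‖w x‖ ≤ K) :
    ∃ M : Lp ℂ 2 m →L[ℂ] Lp ℂ 2 m, ‖M‖ ≤ K ∧ ∀ f, M f =ᵐ[m] fun x => w x * f x := by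
  have hmem : ∀ f : Lp ℂ 2 m, MemLp (fun x => w x * f x) 2 m := fun f => by
    refine (Lp.memLp f).of_le_mul (c := K)
      (hw.aestronglyMeasurable.mul (Lp.aestronglyMeasurable f)) ?_
    filter_upwards [hK] with x hx
    rw [norm_mul]; gcongr
  let M₀ : Lp ℂ 2 m →ₗ[ℂ] Lp ℂ 2 m :=
    { toFun := fun f => (hmem f).toLp
      map_add' := fun f g => by
        apply Lp.ext
        filter_upwards [(hmem (f + g)).coeFn_toLp, (hmem f).coeFn_toLp, (hmem g).coeFn_toLp,
          Lp.coeFn_add (hmem f).toLp (hmem g).toLp, Lp.coeFn_add f g]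
          with x h1 h2 h3 h4 h5
        rw [h1, h4, h5, Pi.add_apply, Pi.add_apply, h2, h3, mul_add]
      map_smul' := fun c f => by
        apply Lp.ext
        filter_upwards [(hmem (c • f)).coeFn_toLp, (hmem f).coeFn_toLp,
          Lp.coeFn_smul c (hmem f).toLp, Lp.coeFn_smul c f] with x h1 h2 h4 h5
        rw [h1, RingHom.id_apply, h4, h5, Pi.smul_apply, Pi.smul_apply, h2]
        simp only [smul_eq_mul]; ring }
  refine ⟨M₀.mkContinuous K fun f => ?_, LinearMap.mkContinuous_norm_le _ K.2 _,
    fun f => (hmem f).coeFn_toLp⟩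
  apply Lp.norm_le_mul_norm_of_ae_le_mul
  filter_upwards [(hmem f).coeFn_toLp, hK] with x h1 h2
  change ‖(hmem f).toLp (fun x => w x * f x) x‖ ≤ _
  rw [h1, norm_mul]; gcongr

end LpOperators

/-! ### Bessel and Riesz systems, and their stability -/

section RieszSystems

variable {X Y ι : Type*} [MeasurableSpace X] [MeasurableSpace Y]

open SeqL2

/-- The synthesis operator of the system `g` is bounded from `ℓ²` to `L²(m)`. -/
def IsBessel (m : Measure X) (g : ι → X → ℂ) : Prop :=
  ∃ T : SeqL2 ι →L[ℂ] Lp ℂ 2 m, ∀ i, T (delta i) =ᵐ[m] g i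

/-- The synthesis operator of the system `g` is an isomorphism from `ℓ²` to `L²(m)`. -/
def IsRiesz (m : Measure X) (g : ι → X → ℂ) : Prop :=
  ∃ T : SeqL2 ι ≃L[ℂ] Lp ℂ 2 m, ∀ i, T (delta i) =ᵐ[m] g i

variable {m : Measure X} {m' : Measure Y} {g g' : ι → X → ℂ}

theorem IsRiesz.isBessel (h : IsRiesz m g) : IsBessel m g :=
  let ⟨T, hT⟩ := h
  ⟨T.toContinuousLinearMap, hT⟩

theorem IsRiesz.of_bijective (T : SeqL2 ι →L[ℂ] Lp ℂ 2 m) (hT : ∀ i, T (delta i) =ᵐ[m] g i)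
    (hinj : ∀ x, T x = 0 → x = 0) (hsurj : ∀ y, ∃ x, T x = y) : IsRiesz m g :=
  ⟨ContinuousLinearEquiv.ofBijective T (LinearMap.ker_eq_bot'.2 hinj)
    (LinearMap.range_eq_top.2 hsurj), hT⟩

theorem IsBessel.congr (h : IsBessel m g) (hg : ∀ i, g i =ᵐ[m] g' i) : IsBessel m g' :=
  let ⟨T, hT⟩ := h
  ⟨T, fun i => (hT i).trans (hg i)⟩

theorem IsRiesz.congr (h : IsRiesz m g) (hg : ∀ i, g i =ᵐ[m] g' i) : IsRiesz m g' :=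
  let ⟨T, hT⟩ := h
  ⟨T, fun i => (hT i).trans (hg i)⟩

theorem IsBessel.comp {g : ι → Y → ℂ} (hg : IsBessel m' g) {φ : X → Y} (hφ : Measurable φ)
    {K : ℝ≥0∞} (hK : K ≠ ∞) (h : m.map φ ≤ K • m') : IsBessel m fun i => g i ∘ φ := by
  obtain ⟨T, hT⟩ := hg
  obtain ⟨P, hP⟩ := exists_pullback hφ hK h
  have hq := quasiMeasurePreserving_of_map_le hφ h
  exact ⟨P ∘L T, fun i => (hP _).trans (hq.ae_eq_comp (hT i))⟩

theorem IsBessel.mono_measure {m₁ m₂ : Measure X} (hg : IsBessel m₂ g) (h : m₁ ≤ m₂) :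
    IsBessel m₁ g :=
  hg.comp measurable_id (K := 1) (by simp) (by simpa using h)

theorem IsRiesz.comp_equiv {g : ι → Y → ℂ} (hg : IsRiesz m' g) (e : X ≃ᵐ Y)
    (h : m.map e = m') : IsRiesz m fun i => g i ∘ e := by
  obtain ⟨T, hT⟩ := hg
  have h1 : m.map e ≤ (1 : ℝ≥0∞) • m' := by simp [h]
  have h2 : m'.map e.symm ≤ (1 : ℝ≥0∞) • m := by simp [← h]
  obtain ⟨P, hP⟩ := exists_pullback e.measurable (by simp) h1
  obtain ⟨P', hP'⟩ := exists_pullback e.symm.measurable (by simp) h2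
  have hq := quasiMeasurePreserving_of_map_le e.measurable h1
  have hq' := quasiMeasurePreserving_of_map_le e.symm.measurable h2
  let E : Lp ℂ 2 m' ≃L[ℂ] Lp ℂ 2 m := ContinuousLinearEquiv.equivOfInverse P P'
    (fun f => by
      apply Lp.ext
      filter_upwards [hP' (P f), hq'.ae_eq_comp (hP f)] with x h1 h2
      rw [h1, h2]; simp)
    (fun f => by
      apply Lp.ext
      filter_upwards [hP (P' f), hq.ae_eq_comp (hP' f)] with x h1 h2
      rw [h1, h2]; simp)
  exact ⟨T.trans E, fun i => (hP _).trans (hq.ae_eq_comp (hT i))⟩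

/-- The new operator is T + MTD, where D is the coordinate projection onto `A` and M is
multiplication by w - 1. Since ‖D‖ ≤ 1, the norm bound does not depend on `A`. -/
theorem exists_perturbation (T : SeqL2 ι →L[ℂ] Lp ℂ 2 m) (hT : ∀ i, T (delta i) =ᵐ[m] g i)
    (A : Set ι) {w : X → ℂ} (hw : Measurable w) (K : ℝ≥0) (hK : ∀ᵐ x ∂m, ‖w x - 1‖ ≤ K) :
    ∃ T' : SeqL2 ι →L[ℂ] Lp ℂ 2 m, ‖T' - T‖ ≤ K * ‖T‖ ∧ ∀ i, T' (delta i) =ᵐ[m]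
      fun x => (A.indicator (fun _ => w x) i + Aᶜ.indicator (fun _ => 1) i) * g i x := by
  classical
  obtain ⟨M, hMn, hM⟩ := exists_mulOperator (hw.sub_const 1) K hK
  obtain ⟨D, hDn, hD⟩ := exists_diag (A.indicator (fun _ : ι => (1 : ℂ))) 1 (fun i => by
    by_cases h : i ∈ A <;> simp [h])
  refine ⟨T + M ∘L (T ∘L D), ?_, fun i => ?_⟩
  · rw [add_sub_cancel_left]
    calc ‖M ∘L (T ∘L D)‖ ≤ ‖M‖ * (‖T‖ * ‖D‖) :=
          (ContinuousLinearMap.opNorm_comp_le _ _).trans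
            (by gcongr; exact ContinuousLinearMap.opNorm_comp_le _ _)
      _ ≤ K * (‖T‖ * 1) := by gcongr; exact hDn
      _ = K * ‖T‖ := by ring
  · by_cases h : i ∈ A
    · have : (T + M ∘L (T ∘L D)) (delta i) = T (delta i) + M (T (delta i)) := by simp [hD, h]
      rw [this]
      filter_upwards [Lp.coeFn_add (T (delta i)) (M (T (delta i))), hM (T (delta i)), hT i]
        with x h1 h2 h3
      rw [h1, Pi.add_apply, h2, h3]
      simp [h]; ring
    · have : (T + M ∘L (T ∘L D)) (delta i) = T (delta i) := by simp [hD, h]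
      rw [this]
      filter_upwards [hT i] with x h3
      rw [h3]; simp [h]

theorem IsBessel.perturb (hg : IsBessel m g) (A : Set ι) {w : X → ℂ} (hw : Measurable w)
    (hw1 : ∀ x, ‖w x‖ ≤ 1) : IsBessel m
      fun i x => (A.indicator (fun _ => w x) i + Aᶜ.indicator (fun _ => 1) i) * g i x := by
  obtain ⟨T, hT⟩ := hg
  obtain ⟨T', -, hT'⟩ := exists_perturbation T hT A hw 2 (ae_of_all _ fun x =>
    (norm_sub_le _ _).trans (by have := hw1 x; norm_num; linarith))
  exact ⟨T', hT'⟩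

/-- A system obtained from a Riesz basis by multiplying some of its members by a function that is
uniformly close to `1` is a Riesz basis. -/
theorem IsRiesz.perturb (hg : IsRiesz m g) : ∃ ε : ℝ≥0, 0 < ε ∧ ∀ (A : Set ι) (w : X → ℂ),
    Measurable w → (∀ᵐ x ∂m, ‖w x - 1‖ ≤ ε) → IsRiesz m
      fun i x => (A.indicator (fun _ => w x) i + Aᶜ.indicator (fun _ => 1) i) * g i x := by
  obtain ⟨T, hT⟩ := hg
  -- Invertible operators form an open set, so a whole ball around T consists of isomorphisms.
  obtain ⟨r, hr, hball⟩ := Metric.mem_nhds_iff.1 (ContinuousLinearEquiv.nhds T)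
  lift r to ℝ≥0 using hr.le
  have hr' : 0 < r := by exact_mod_cast hr
  refine ⟨r / (‖T.toContinuousLinearMap‖₊ + 1), by positivity, fun A w hw hwε => ?_⟩
  obtain ⟨T', hT'n, hT'⟩ := exists_perturbation T.toContinuousLinearMap hT A hw _ hwε
  have hmem : T' ∈ Metric.ball T.toContinuousLinearMap r := by
    rw [mem_ball_iff_norm]
    refine hT'n.trans_lt ?_
    push_cast
    rw [div_mul_eq_mul_div, div_lt_iff₀ (by positivity)]
    have : (0 : ℝ) < r := hr
    nlinarith [norm_nonneg T.toContinuousLinearMap]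
  obtain ⟨S, rfl⟩ := hball hmem
  exact ⟨S, hT'⟩

end RieszSystems

/-! ### Tensor products with the Fourier basis of the circle -/

section ProductSystems

open SeqL2 AddCircle

variable {X ι : Type*} [MeasurableSpace X] {m : Measure X}

theorem norm_fourier_apply (k : ℤ) (t : AddCircle (1 : ℝ)) : ‖fourier k t‖ = 1 := by
  rw [fourier_apply]; exact Circle.norm_coe _

theorem exists_tensor_fourier (m : Measure X) [SFinite m] (k : ℤ) :
    ∃ V : Lp ℂ 2 m →ₗᵢ[ℂ] Lp ℂ 2 (m.prod (haarAddCircle (T := 1))),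
      ∀ f, V f =ᵐ[m.prod haarAddCircle] fun z => fourier k z.2 * f z.1 := by
  have hmp : MeasurePreserving (Prod.fst : X × AddCircle (1 : ℝ) → X)
      (m.prod haarAddCircle) m := measurePreserving_fst
  have hle : (m.prod (haarAddCircle (T := 1))).map Prod.fst ≤ (1 : ℝ≥0∞) • m := by
    rw [hmp.map_eq, one_smul]
  obtain ⟨P, hP⟩ := exists_pullback hmp.measurable (by simp) hle
  have hw : Measurable fun z : X × AddCircle (1 : ℝ) => fourier k z.2 :=
    (fourier k).continuous.measurable.comp measurable_snd
  have hw1 : ∀ z : X × AddCircle (1 : ℝ), ‖fourier k z.2‖ = 1 := fun z => norm_fourier_apply k z.2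
  obtain ⟨M, -, hM⟩ := exists_mulOperator (m := m.prod haarAddCircle) hw 1
    (ae_of_all _ fun z => (hw1 z).le)
  have hMP : ∀ f, M (P f) =ᵐ[m.prod haarAddCircle] fun z => fourier k z.2 * f z.1 := fun f => by
    filter_upwards [hM (P f), hP f] with z h1 h2
    rw [h1, h2]; rfl
  refine ⟨⟨(M ∘L P).toLinearMap, fun f => ?_⟩, hMP⟩
  change ‖M (P f)‖ = ‖f‖
  rw [Lp.norm_def, Lp.norm_def, eLpNorm_congr_norm_ae (g := f ∘ Prod.fst),
    eLpNorm_comp_measurePreserving (Lp.aestronglyMeasurable f) hmp]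
  filter_upwards [hMP f] with z h
  rw [h, norm_mul, hw1, one_mul]; rfl

theorem integral_conj_fourier_mul_fourier {k l : ℤ} (h : k ≠ l) :
    ∫ t : AddCircle (1 : ℝ), (starRingEnd ℂ) (fourier k t) * fourier l t ∂haarAddCircle = 0 := by
  have h1 := fourierCoeff_fourier (T := (1 : ℝ)) l
  have h2 := congrFun h1 k
  rw [Pi.single_eq_of_ne h] at h2
  rw [← h2, fourierCoeff]
  simp only [smul_eq_mul, fourier_neg]

theorem ae_eq_zero_of_fourierCoeff_eq_zero {f : AddCircle (1 : ℝ) → ℂ}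
    (hf : MemLp f 2 haarAddCircle) (h : ∀ k, fourierCoeff f k = 0) :
    f =ᵐ[haarAddCircle] 0 := by
  have h0 : hf.toLp f = 0 := by
    apply fourierBasis.repr.injective
    ext k
    rw [fourierBasis_repr, map_zero,
      show fourierCoeff (hf.toLp f) k = fourierCoeff f k from integral_congr_ae (by
      filter_upwards [hf.coeFn_toLp] with t ht
      rw [ht]), h k]
    simp
  filter_upwards [hf.coeFn_toLp, Lp.coeFn_zero ℂ 2 (haarAddCircle (T := 1))] with t h1 h2
  rw [← h1, h0, h2]

/-- Testing against indicators of measurable sets shows that each Fourier coefficient of the slice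
h(x, ·) vanishes for almost every x. Almost every slice is then zero by completeness of the Fourier
basis, and h is zero by Fubini. -/
theorem eq_zero_of_inner_tensor_fourier [IsFiniteMeasure m]
    {V : ℤ → Lp ℂ 2 m →ₗᵢ[ℂ] Lp ℂ 2 (m.prod (haarAddCircle (T := 1)))}
    (hV : ∀ k f, V k f =ᵐ[m.prod haarAddCircle] fun z => fourier k z.2 * f z.1)
    (h : Lp ℂ 2 (m.prod (haarAddCircle (T := 1)))) (h0 : ∀ k f, inner ℂ (V k f) h = 0) :
    h = 0 := by
  have hint : Integrable h (m.prod haarAddCircle) := (Lp.memLp h).integrable (by norm_num)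
  have hk : ∀ k : ℤ, Integrable (fun z => fourier (-k) z.2 * h z)
      (m.prod (haarAddCircle (T := 1))) := fun k => by
    refine hint.bdd_mul (c := 1) ?_ (ae_of_all _ fun z => (norm_fourier_apply _ _).le)
    exact ((fourier (-k)).continuous.measurable.comp measurable_snd).aestronglyMeasurable
  have hF : ∀ k : ℤ, (fun x => fourierCoeff (fun t => h (x, t)) k) =ᵐ[m] 0 := by
    intro k
    refine Integrable.ae_eq_zero_of_forall_setIntegral_eq_zero ?_ fun A hA _ => ?_
    · exact (hk k).integral_prod_left
    · have h1 := h0 k (indicatorConstLp 2 hA (measure_ne_top m A) 1)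
      rw [L2.inner_def] at h1
      have h2 : ∫ z, A.indicator (fun _ => (1 : ℂ)) z.1 * (fourier (-k) z.2 * h z)
          ∂(m.prod haarAddCircle) = 0 := by
        rw [← h1]
        apply integral_congr_ae
        have hq : Measure.QuasiMeasurePreserving (Prod.fst : X × AddCircle (1 : ℝ) → X)
          (m.prod haarAddCircle) m := Measure.quasiMeasurePreserving_fst
        filter_upwards [hV k (indicatorConstLp 2 hA (measure_ne_top m A) 1),
          hq.ae_eq_comp (indicatorConstLp_coeFn (p := 2) (hs := hA)
            (hμs := measure_ne_top m A) (c := (1 : ℂ)))] with z e1 e2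
        simp only [Function.comp] at e2
        rw [e1, e2, RCLike.inner_apply', map_mul, fourier_neg]
        by_cases hz : z.1 ∈ A <;> simp [hz]
      rw [integral_prod] at h2
      · rw [← integral_indicator hA, ← h2]
        congr 1 with x
        by_cases hx : x ∈ A
        · simp [hx, fourierCoeff]
        · simp [hx]
      · refine (hk k).bdd_mul (c := 1) ?_ (ae_of_all _ fun z => ?_)
        · exact ((measurable_const.indicator hA).comp measurable_fst).aestronglyMeasurable
        · by_cases hz : z.1 ∈ A <;> simp [hz]
  have hsq : ∀ᵐ x ∂m, Integrable (fun t => ‖h (x, t)‖ ^ 2) (haarAddCircle (T := 1)) :=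
    ((memLp_two_iff_integrable_sq_norm (Lp.aestronglyMeasurable h)).1 (Lp.memLp h)).prod_right_ae
  have hsm : StronglyMeasurable h := Lp.stronglyMeasurable h
  apply Lp.ext
  refine EventuallyEq.trans ?_ (Lp.coeFn_zero _ _ _).symm
  change (m.prod haarAddCircle) {z | ¬ h z = 0} = 0
  rw [Measure.measure_prod_null (s := {z | ¬ h z = 0})
    (hsm.measurable (measurableSet_singleton (0 : ℂ)).compl)]
  filter_upwards [hsq, ae_all_iff.2 hF] with x hx1 hx2
  have hm : MemLp (fun t => h (x, t)) 2 haarAddCircle :=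
    (memLp_two_iff_integrable_sq_norm
      (hsm.comp_measurable measurable_prodMk_left).aestronglyMeasurable).2 hx1
  exact ae_eq_zero_of_fourierCoeff_eq_zero hm hx2

theorem isHilbertSum_tensor_fourier [IsFiniteMeasure m]
    {V : ℤ → Lp ℂ 2 m →ₗᵢ[ℂ] Lp ℂ 2 (m.prod (haarAddCircle (T := 1)))}
    (hV : ∀ k f, V k f =ᵐ[m.prod haarAddCircle] fun z => fourier k z.2 * f z.1) :
    IsHilbertSum ℂ (fun _ : ℤ => Lp ℂ 2 m) V := by
  refine IsHilbertSum.mk (fun k l hkl f g => ?_) ?_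
  · rw [L2.inner_def]
    have : ∫ z : X × AddCircle (1 : ℝ), ((starRingEnd ℂ) (f z.1) * g z.1) *
        ((starRingEnd ℂ) (fourier k z.2) * fourier l z.2) ∂(m.prod haarAddCircle) = 0 := by
      rw [integral_prod_mul (fun x => (starRingEnd ℂ) (f x) * g x)
        (fun t => (starRingEnd ℂ) (fourier k t) * fourier l t),
        integral_conj_fourier_mul_fourier hkl, mul_zero]
    rw [← this]
    apply integral_congr_ae
    filter_upwards [hV k f, hV l g] with z h1 h2
    rw [h1, h2, RCLike.inner_apply', map_mul]
    ring
  · rw [top_le_iff, Submodule.topologicalClosure_eq_top_iff, Submodule.eq_bot_iff]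
    intro h hh
    refine eq_zero_of_inner_tensor_fourier hV h fun k f => ?_
    exact hh _ (Submodule.mem_iSup_of_mem k ⟨f, rfl⟩)

theorem exists_curry (ι : Type*) : ∃ G : SeqL2 (ι × ℤ) ≃ₗᵢ[ℂ] lp (fun _ : ℤ => SeqL2 ι) 2,
    ∀ p, G (delta p) = lp.single 2 p.2 (delta p.1) := by
  classical
  have ho := orthonormal_iff_ite.1 (orthonormal_delta (ι := ι))
  have hv : Orthonormal ℂ (fun p : ι × ℤ =>
      (lp.single 2 p.2 (delta p.1) : lp (fun _ : ℤ => SeqL2 ι) 2)) := by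
    rw [orthonormal_iff_ite]
    rintro ⟨i, k⟩ ⟨j, l⟩
    rw [lp.inner_single_left]
    by_cases hkl : k = l
    · subst hkl; simp [ho]
    · simp [hkl]
  let b := HilbertBasis.mkOfOrthogonalEqBot hv (by
    rw [Submodule.eq_bot_iff]
    intro y hy
    ext1
    funext k
    refine eq_of_inner_delta fun i => ?_
    have := hy _ (Submodule.subset_span ⟨(i, k), rfl⟩)
    rw [lp.inner_single_left] at this
    simpa using this)
  refine ⟨b.repr.symm, fun p => ?_⟩
  have h1 : b p = lp.single 2 p.2 (delta p.1) := by
    simp [b]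
  rw [← h1]
  simp only [delta]
  convert! b.repr_symm_single p

theorem IsBessel.prod_fourier [IsFiniteMeasure m] {g : ι → X → ℂ} (hg : IsBessel m g) :
    IsBessel (m.prod (haarAddCircle (T := 1)))
      fun (p : ι × ℤ) z => fourier p.2 z.2 * g p.1 z.1 := by
  obtain ⟨T, hT⟩ := hg
  choose V hV using exists_tensor_fourier m
  obtain ⟨G, hG⟩ := exists_curry ι
  let E := (isHilbertSum_tensor_fourier hV).linearIsometryEquiv.symm
  refine ⟨E.toContinuousLinearEquiv.toContinuousLinearMap ∘L
    (lp.mapCLM 2 (fun _ : ℤ => T) (norm_nonneg T) (fun _ => le_rfl)) ∘L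
      G.toContinuousLinearEquiv.toContinuousLinearMap, fun p => ?_⟩
  have h1 : lp.mapCLM 2 (fun _ : ℤ => T) (norm_nonneg T) (fun _ => le_rfl) (G (delta p)) =
      lp.single 2 p.2 (T (delta p.1)) := by
    rw [hG]
    ext1
    funext l
    by_cases h : l = p.2
    · subst h; simp [lp.mapCLM]
    · simp [lp.mapCLM, Pi.single_eq_of_ne h]
  change E (lp.mapCLM 2 (fun _ : ℤ => T) (norm_nonneg T) (fun _ => le_rfl) (G (delta p))) =ᵐ[_] _
  rw [h1, IsHilbertSum.linearIsometryEquiv_symm_apply_single]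
  have hq : Measure.QuasiMeasurePreserving (Prod.fst : X × AddCircle (1 : ℝ) → X)
    (m.prod haarAddCircle) m := Measure.quasiMeasurePreserving_fst
  filter_upwards [hV p.2 (T (delta p.1)), hq.ae_eq_comp (hT p.1)] with z e1 e2
  simp only [Function.comp] at e2
  rw [e1, e2]

/-- L² of the product is the Hilbert sum over k of the copies of L²(m) multiplied by the k-th
character. After ℓ²(ι × ℤ) is regrouped as ℓ²(ℤ; ℓ²(ι)), the synthesis operator acts as T in each
summand, so it is inverted summand by summand. -/
theorem IsRiesz.prod_fourier [IsFiniteMeasure m] {g : ι → X → ℂ} (hg : IsRiesz m g) :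
    IsRiesz (m.prod (haarAddCircle (T := 1)))
      fun (p : ι × ℤ) z => fourier p.2 z.2 * g p.1 z.1 := by
  obtain ⟨T, hT⟩ := hg
  choose V hV using exists_tensor_fourier m
  obtain ⟨G, hG⟩ := exists_curry ι
  let E := (isHilbertSum_tensor_fourier hV).linearIsometryEquiv.symm
  let T₁ := T.toContinuousLinearMap
  let T₂ := T.symm.toContinuousLinearMap
  let L : lp (fun _ : ℤ => SeqL2 ι) 2 ≃L[ℂ] lp (fun _ : ℤ => Lp ℂ 2 m) 2 :=
    ContinuousLinearEquiv.equivOfInverse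
      (lp.mapCLM 2 (fun _ : ℤ => T₁) (norm_nonneg T₁) (fun _ => le_rfl))
      (lp.mapCLM 2 (fun _ : ℤ => T₂) (norm_nonneg T₂) (fun _ => le_rfl))
      (fun x => by ext1; funext l; simp [lp.mapCLM, T₁, T₂])
      (fun x => by ext1; funext l; simp [lp.mapCLM, T₁, T₂])
  refine ⟨(G.toContinuousLinearEquiv.trans L).trans E.toContinuousLinearEquiv, fun p => ?_⟩
  have h1 : L (G (delta p)) = lp.single 2 p.2 (T (delta p.1)) := by
    rw [hG]
    ext1
    funext l
    by_cases h : l = p.2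
    · subst h; simp [L, lp.mapCLM, T₁]
    · simp [L, lp.mapCLM, Pi.single_eq_of_ne h]
  change E (L (G (delta p))) =ᵐ[_] _
  rw [h1, IsHilbertSum.linearIsometryEquiv_symm_apply_single]
  have hq : Measure.QuasiMeasurePreserving (Prod.fst : X × AddCircle (1 : ℝ) → X)
    (m.prod haarAddCircle) m := Measure.quasiMeasurePreserving_fst
  filter_upwards [hV p.2 (T (delta p.1)), hq.ae_eq_comp (hT p.1)] with z e1 e2
  simp only [Function.comp] at e2
  rw [e1, e2]

end ProductSystems

/-! ### Thickening a set vertically, and the difference operator -/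

section Thickening

open SeqL2 AddCircle

variable {X ι κ : Type*}

/-- Vertical translation by `a`. -/
def vshift (a : ℝ) (z : X × ℝ) : X × ℝ := (z.1, z.2 + a)

/-- The union of the vertical translates of `C` by the elements of `[-1/2, 1/2]`. -/
def thicken (C : Set (X × ℝ)) : Set (X × ℝ) :=
  {z | ∃ s ∈ Icc (-(1 / 2) : ℝ) (1 / 2), vshift (-s) z ∈ C}

/-- The projection to the product with the circle. -/
def toCircleProd (z : X × ℝ) : X × AddCircle (1 : ℝ) := (z.1, (z.2 : AddCircle (1 : ℝ)))

/-- All vertical sections of `C` are intervals. -/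
def VerticallyConvex (C : Set (X × ℝ)) : Prop :=
  ∀ x s t r, (x, s) ∈ C → (x, t) ∈ C → s ≤ r → r ≤ t → (x, r) ∈ C

theorem vshift_vshift (a b : ℝ) (z : X × ℝ) : vshift a (vshift b z) = vshift (b + a) z := by
  simp [vshift, add_assoc]

theorem vshift_zero (z : X × ℝ) : vshift 0 z = z := by simp [vshift]

theorem vshift_mem_thicken {C : Set (X × ℝ)} {z : X × ℝ} (hz : z ∈ C) {s : ℝ}
    (hs : s ∈ Icc (-(1 / 2) : ℝ) (1 / 2)) : vshift s z ∈ thicken C :=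
  ⟨s, hs, by simpa [vshift_vshift, vshift_zero] using hz⟩

theorem VerticallyConvex.thicken {C : Set (X × ℝ)} (hC : VerticallyConvex C) :
    VerticallyConvex (thicken C) := by
  rintro x s t r ⟨a, ⟨ha, ha'⟩, hs⟩ ⟨b, ⟨hb, hb'⟩, ht⟩ hsr hrt
  simp only [vshift] at hs ht
  -- The height r is either within 1/2 above the base point under s, or r - 1/2 lies between the two
  -- base points.
  rcases le_total r (s + -a + 1 / 2) with h' | h'
  · refine ⟨r - (s + -a), ⟨by linarith, by linarith⟩, ?_⟩
    simp only [vshift]; convert hs using 2; ring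
  · exact ⟨1 / 2, by norm_num, hC x _ _ _ hs ht (by simp only; linarith)
      (by simp only; linarith)⟩

/-- If z = c + ae and z + e = c' + be with |a|, |b| ≤ 1/2, then z + e/2 lies above c and below c' on
the same vertical line. -/
theorem VerticallyConvex.vshift_half_mem {C : Set (X × ℝ)} (hC : VerticallyConvex C) {z : X × ℝ}
    (h0 : z ∈ _root_.thicken C) (h1 : vshift 1 z ∈ _root_.thicken C) : vshift (1 / 2) z ∈ C := by
  obtain ⟨x, t⟩ := z
  obtain ⟨a, ⟨ha, ha'⟩, hs⟩ := h0
  obtain ⟨b, ⟨hb, hb'⟩, ht⟩ := h1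
  simp only [vshift] at *
  exact hC x _ _ _ hs ht (by linarith) (by linarith)

theorem exists_int_vshift_mem_thicken {C : Set (X × ℝ)} {z : X × ℝ} (hz : z.1 ∈ Prod.fst '' C) :
    ∃ k : ℤ, vshift k z ∈ thicken C := by
  obtain ⟨⟨x, s⟩, hs, hx⟩ := hz
  -- The ceiling puts the shifted height in [s - 1/2, s + 1/2): the section of the thickening is
  -- long enough to meet every coset of ℤ.
  refine ⟨⌈s - 1 / 2 - z.2⌉, z.2 + ⌈s - 1 / 2 - z.2⌉ - s, ⟨?_, ?_⟩, ?_⟩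
  · linarith [Int.le_ceil (s - 1 / 2 - z.2)]
  · linarith [Int.ceil_lt_add_one (s - 1 / 2 - z.2)]
  · simp only [vshift]
    convert hs using 2
    · exact hx.symm
    · ring

theorem toCircleProd_vshift_intCast (k : ℤ) (z : X × ℝ) :
    toCircleProd (vshift k z) = toCircleProd z := by
  simp only [toCircleProd, vshift, Prod.mk.injEq, true_and]
  rw [AddCircle.coe_add, add_eq_left, AddCircle.coe_eq_zero_iff]
  exact ⟨k, by simp⟩

variable [MeasurableSpace X]

theorem measurable_vshift (a : ℝ) : Measurable (vshift a : X × ℝ → X × ℝ) :=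
  measurable_fst.prodMk (measurable_snd.add_const a)

theorem measurable_toCircleProd : Measurable (toCircleProd : X × ℝ → _) :=
  measurable_fst.prodMk (AddCircle.measurable_mk'.comp measurable_snd)

variable {ν : Measure X} [SFinite ν]

theorem measurePreserving_vshift (a : ℝ) :
    MeasurePreserving (vshift a) (ν.prod volume) (ν.prod volume) :=
  (MeasurePreserving.id ν).prod (measurePreserving_add_right volume a)

theorem map_vshift_restrict_le {C : Set (X × ℝ)} {s : ℝ} (hs : s ∈ Icc (-(1 / 2) : ℝ) (1 / 2)) :
    ((ν.prod volume).restrict C).map (vshift s) ≤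
      (1 : ℝ≥0∞) • (ν.prod volume).restrict (thicken C) := by
  rw [one_smul]
  refine Measure.le_iff.2 fun A hA => ?_
  rw [Measure.map_apply (measurable_vshift s) hA, Measure.restrict_apply hA,
    Measure.restrict_apply (measurable_vshift s hA),
    ← (measurePreserving_vshift (ν := ν) s).map_eq]
  refine le_trans ?_ (Measure.le_map_apply (measurable_vshift s).aemeasurable _)
  rw [(measurePreserving_vshift (ν := ν) s).map_eq]
  exact measure_mono fun z hz => ⟨hz.1, vshift_mem_thicken hz.2 hs⟩

theorem volume_eq_haarAddCircle_one : (volume : Measure (AddCircle (1 : ℝ))) = haarAddCircle := by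
  rw [volume_eq_smul_haarAddCircle]; simp

theorem map_coe_restrict_Ioc (a : ℝ) : (volume.restrict (Ioc a (a + 1))).map
    ((↑) : ℝ → AddCircle (1 : ℝ)) = haarAddCircle := by
  rw [← volume_eq_haarAddCircle_one]
  exact (AddCircle.measurePreserving_mk (1 : ℝ) a).map_eq

theorem map_coe_restrict_le (N : ℕ) (a : ℝ) : (volume.restrict (Ioc a (a + N))).map
    ((↑) : ℝ → AddCircle (1 : ℝ)) ≤ (N : ℝ≥0∞) • haarAddCircle := by
  induction N with
  | zero => simp
  | succ N ih =>
    have h : Ioc a (a + (N + 1 : ℕ)) ⊆ Ioc a (a + N) ∪ Ioc (a + N) (a + N + 1) := by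
      intro t ht
      rcases le_or_gt t (a + N) with h | h
      · exact Or.inl ⟨ht.1, h⟩
      · refine Or.inr ⟨h, ?_⟩
        have := ht.2; push_cast at this; linarith
    calc _ ≤ (volume.restrict (Ioc a (a + N)) + volume.restrict (Ioc (a + N) (a + N + 1))).map
          ((↑) : ℝ → AddCircle (1 : ℝ)) := by
          refine Measure.map_mono ?_ AddCircle.measurable_mk'
          exact (Measure.restrict_mono h le_rfl).trans (Measure.restrict_union_le _ _)
      _ = (volume.restrict (Ioc a (a + N))).map ((↑) : ℝ → AddCircle (1 : ℝ)) +
          haarAddCircle := by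
          rw [Measure.map_add _ _ AddCircle.measurable_mk', map_coe_restrict_Ioc]
      _ ≤ _ := by
          rw [Nat.cast_add, Nat.cast_one, add_smul, one_smul]
          gcongr

/-- A set of heights in (-N, N] wraps around the circle at most 2N times. This makes periodic
extension a bounded operator. -/
theorem map_toCircleProd_restrict_le {B : Set (X × ℝ)} {P : Set X} {N : ℕ}
    (hB : B ⊆ P ×ˢ Ioc (-N : ℝ) N) : ((ν.prod volume).restrict B).map toCircleProd ≤
      ((2 * N : ℕ) : ℝ≥0∞) • (ν.restrict P).prod haarAddCircle := by
  have h1 : (ν.prod volume).restrict B ≤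
      (ν.restrict P).prod (volume.restrict (Ioc (-N : ℝ) (-N + (2 * N : ℕ)))) := by
    rw [Measure.prod_restrict]
    refine Measure.restrict_mono (hB.trans ?_) le_rfl
    push_cast
    rw [show (-N + 2 * N : ℝ) = N by ring]
  refine (Measure.map_mono h1 measurable_toCircleProd).trans ?_
  rw [show (toCircleProd : X × ℝ → _) = Prod.map id (↑) from rfl,
    ← Measure.map_prod_map _ _ measurable_id AddCircle.measurable_mk', Measure.map_id,
    ← Measure.prod_smul_right]
  exact Measure.prod_mono le_rfl (map_coe_restrict_le _ _)

theorem map_toCircleProd_restrict_eq (P : Set X) :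
    ((ν.prod volume).restrict (P ×ˢ Ioc (0 : ℝ) 1)).map toCircleProd =
      (ν.restrict P).prod haarAddCircle := by
  rw [← Measure.prod_restrict, show (toCircleProd : X × ℝ → _) = Prod.map id (↑) from rfl,
    ← Measure.map_prod_map _ _ measurable_id AddCircle.measurable_mk', Measure.map_id]
  have := map_coe_restrict_Ioc 0
  rw [zero_add] at this
  rw [this]

/-- A function on the product with the circle is determined by its periodic extension to
`thicken C`. -/
theorem ae_eq_zero_of_comp_toCircleProd {C : Set (X × ℝ)} (hΩ : MeasurableSet (thicken C))
    (hP : MeasurableSet (Prod.fst '' C)) {h : X × AddCircle (1 : ℝ) → ℂ} (hm : Measurable h)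
    (h0 : h ∘ toCircleProd =ᵐ[(ν.prod volume).restrict (thicken C)] 0) :
    h =ᵐ[(ν.restrict (Prod.fst '' C)).prod haarAddCircle] 0 := by
  rw [← map_toCircleProd_restrict_eq]
  refine (ae_map_iff measurable_toCircleProd.aemeasurable
    (hm (measurableSet_singleton (0 : ℂ)))).2 ?_
  rw [ae_restrict_iff' (hP.prod measurableSet_Ioc)]
  have h1 := (ae_restrict_iff' hΩ).1 h0
  have h2 : ∀ᵐ z ∂ν.prod volume, ∀ k : ℤ, vshift k z ∈ thicken C →
      h (toCircleProd z) = 0 := by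
    rw [ae_all_iff]
    intro k
    filter_upwards [(measurePreserving_vshift (ν := ν) k).quasiMeasurePreserving.ae h1] with z hz hk
    have := hz hk
    simpa [toCircleProd_vshift_intCast] using this
  filter_upwards [h2] with z hz hzP
  obtain ⟨k, hk⟩ := exists_int_vshift_mem_thicken hzP.1
  exact hz k hk

/-- A function on `thicken C` whose translates by `1/2` and `-1/2` agree on `C` takes equal values
at points which differ by an integer vertical translation. -/
theorem ae_eq_vshift_of_forall_half {C : Set (X × ℝ)} (hC : VerticallyConvex C)
    {f : X × ℝ → ℂ}
    (hf : ∀ᵐ z ∂(ν.prod volume), z ∈ C → f (vshift (-(1 / 2)) z) = f (vshift (1 / 2) z)) :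
    ∀ᵐ z ∂(ν.prod volume), ∀ k : ℤ, z ∈ thicken C → vshift k z ∈ thicken C →
      f (vshift k z) = f z := by
  have h1 : ∀ᵐ z ∂(ν.prod volume), ∀ j : ℤ, vshift (j + 1 / 2) z ∈ C →
      f (vshift j z) = f (vshift (j + 1) z) := by
    rw [ae_all_iff]
    intro j
    filter_upwards [(measurePreserving_vshift (ν := ν) (j + 1 / 2)).quasiMeasurePreserving.ae hf]
      with z hz hzC
    have := hz hzC
    rw [vshift_vshift, vshift_vshift] at this
    convert this using 3 <;> ring
  filter_upwards [h1] with z hz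
  -- Induction along unit steps: vertical convexity keeps every intermediate translate in the
  -- thickening, and the midpoint of each step lies in `C`, where the hypothesis applies.
  have key : ∀ a b : ℤ, a ≤ b → vshift a z ∈ thicken C → vshift b z ∈ thicken C →
      f (vshift b z) = f (vshift a z) := by
    intro a b hab ha
    induction b, hab using Int.leInduction with
    | base => intro; rfl
    | succ b hab ih =>
      intro hb
      have hab' : (a : ℝ) ≤ b := by exact_mod_cast hab
      push_cast at hb ⊢
      have hb' : vshift b z ∈ thicken C := hC.thicken z.1 _ _ _ ha hb (by linarith) (by linarith)
      rw [← ih hb', hz b]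
      have := hC.vshift_half_mem hb' (by rwa [vshift_vshift])
      rwa [vshift_vshift] at this
  intro k h0 hk
  have h0' : vshift ((0 : ℤ) : ℝ) z ∈ thicken C := by simpa [vshift_zero] using h0
  have e : vshift ((0 : ℤ) : ℝ) z = z := by simp [vshift_zero]
  rcases le_total 0 k with h | h
  · rw [key 0 k h h0' hk, e]
  · rw [← key k 0 h hk h0', e]

/-- The representative in `(0, 1]` of a point of the circle. -/
def circleRep (t : AddCircle (1 : ℝ)) : ℝ := AddCircle.equivIoc (1 : ℝ) 0 t

theorem circleRep_mem (t : AddCircle (1 : ℝ)) : circleRep t ∈ Ioc (0 : ℝ) 1 := by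
  have h := (AddCircle.equivIoc (1 : ℝ) 0 t).2
  exact ⟨h.1, h.2.trans_eq (zero_add 1)⟩

theorem measurePreserving_circleRep :
    MeasurePreserving circleRep haarAddCircle (volume.restrict (Ioc (0 : ℝ) 1)) := by
  rw [← volume_eq_haarAddCircle_one]
  have h1 := AddCircle.measurePreserving_equivIoc (1 : ℝ) (a := 0)
  have h2 := (measurePreserving_subtype_coe (μa := volume)
    (measurableSet_Ioc (a := (0 : ℝ)) (b := 0 + 1))).comp h1
  exact ⟨h2.1, h2.2.trans (by rw [zero_add])⟩

theorem exists_int_circleRep_coe (t : ℝ) : ∃ j : ℤ, t = circleRep (t : AddCircle (1 : ℝ)) + j := by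
  have h : ((circleRep (t : AddCircle (1 : ℝ)) : ℝ) : AddCircle (1 : ℝ)) = t :=
    AddCircle.coe_equivIoc ..
  have h2 : ((t - circleRep (t : AddCircle (1 : ℝ)) : ℝ) : AddCircle (1 : ℝ)) = 0 := by
    rw [AddCircle.coe_sub, h, sub_self]
  obtain ⟨j, hj⟩ := (AddCircle.coe_eq_zero_iff _).1 h2
  exact ⟨j, by simp at hj; linarith⟩

/-- An `L²` function on `thicken C` whose translates by `1/2` and `-1/2` agree on `C` is
the restriction of a periodic function. -/
theorem exists_comp_toCircleProd_eq {C : Set (X × ℝ)} (hC : VerticallyConvex C)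
    (hΩ : MeasurableSet (thicken C)) {P : Set X} {N : ℕ}
    (hN : thicken C ⊆ P ×ˢ Ioc (-N : ℝ) N) (f : Lp ℂ 2 ((ν.prod volume).restrict (thicken C)))
    (hf : ∀ᵐ z ∂(ν.prod volume), z ∈ C → f (vshift (-(1 / 2)) z) = f (vshift (1 / 2) z)) :
    ∃ h : Lp ℂ 2 ((ν.restrict P).prod (haarAddCircle (T := 1))),
      h ∘ toCircleProd =ᵐ[(ν.prod volume).restrict (thicken C)] f := by
  set F : X × ℝ → ℂ := (thicken C).indicator f with hF
  have hfm : StronglyMeasurable f := Lp.stronglyMeasurable f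
  have hFm : Measurable F := hfm.measurable.indicator hΩ
  have hFL : MemLp F 2 (ν.prod volume) := (memLp_indicator_iff_restrict hΩ).2 (Lp.memLp f)
  set s : Finset ℤ := Finset.Icc (-(2 * N : ℤ)) (2 * N)
  set cnt : X × ℝ → ℂ := fun z => ∑ k ∈ s, (thicken C).indicator (fun _ => 1) (vshift k z)
    with hcnt
  -- The periodic function is the average of f over the integer translates that land in the
  -- thickening. Almost everywhere these values coincide, and averaging gives measurability without
  -- choosing a translate.
  set H : X × ℝ → ℂ := fun z => (cnt z)⁻¹ * ∑ k ∈ s, F (vshift k z) with hH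
  have hcm : Measurable cnt := Finset.measurable_sum _ fun k _ =>
    (measurable_const.indicator hΩ).comp (measurable_vshift _)
  have hc : ∀ z, ∃ n : ℕ, cnt z = n := fun z => by
    classical
    refine ⟨∑ k ∈ s, if vshift k z ∈ thicken C then 1 else 0, ?_⟩
    push_cast
    simp [hcnt, indicator_apply]
  have hHm : Measurable H := hcm.inv.mul (Finset.measurable_sum _ fun k _ =>
    hFm.comp (measurable_vshift _))
  have hHL : MemLp H 2 (ν.prod volume) := by
    have hS : MemLp (fun z => ∑ k ∈ s, F (vshift k z)) 2 (ν.prod volume) :=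
      memLp_finsetSum _ fun k _ => hFL.comp_measurePreserving (measurePreserving_vshift _)
    refine hS.of_le_mul (c := 1) hHm.aestronglyMeasurable (ae_of_all _ fun z => ?_)
    rw [hH, norm_mul]
    gcongr
    obtain ⟨n, hn⟩ := hc z
    rw [hn, norm_inv, Complex.norm_natCast]
    -- This includes a zero count, whose inverse is 0 by convention.
    exact Nat.cast_inv_le_one n
  set R : X × AddCircle (1 : ℝ) → X × ℝ := Prod.map id circleRep
  have hRmp : MeasurePreserving R ((ν.restrict P).prod haarAddCircle)
      ((ν.restrict P).prod (volume.restrict (Ioc (0 : ℝ) 1))) :=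
    (MeasurePreserving.id _).prod measurePreserving_circleRep
  have hhL : MemLp (H ∘ R) 2 ((ν.restrict P).prod haarAddCircle) := by
    refine MemLp.comp_measurePreserving (hHL.mono_measure ?_) hRmp
    rw [Measure.prod_restrict]
    exact Measure.restrict_le_self
  refine ⟨hhL.toLp, ?_⟩
  have hq := quasiMeasurePreserving_of_map_le measurable_toCircleProd
    (map_toCircleProd_restrict_le (ν := ν) hN)
  refine (hq.ae_eq_comp hhL.coeFn_toLp).trans ?_
  refine (ae_restrict_iff' hΩ).2 ?_
  filter_upwards [ae_eq_vshift_of_forall_half hC hf] with z hz hzΩ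
  obtain ⟨j, hj⟩ := exists_int_circleRep_coe z.2
  set t := circleRep (z.2 : AddCircle (1 : ℝ))
  have hRz : R (toCircleProd z) = vshift (-j) z := by
    simp only [R, toCircleProd, vshift, Prod.map, id]
    change (z.1, t) = _
    rw [hj]; simp
  -- The translate z itself must be among those counted, so that the denominator is nonzero. The
  -- bound on heights in the thickening ensures this.
  have hjs : j ∈ s := by
    have h1 := (hN hzΩ).2
    have h2 : t ∈ Ioc (0 : ℝ) 1 := circleRep_mem _
    have h3 : -(N : ℝ) - 1 < j := by linarith [h1.1, h2.2]
    have h4 : (j : ℝ) < N := by linarith [h1.2, h2.1]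
    have h3' : -(N : ℤ) - 1 < j := by exact_mod_cast h3
    have h4' : j < (N : ℤ) := by exact_mod_cast h4
    simp only [s, Finset.mem_Icc]
    lia
  have hval : ∀ k : ℤ, F (vshift k (vshift (-j) z)) =
      (thicken C).indicator (fun _ => 1) (vshift k (vshift (-j) z)) * f z := fun k => by
    rw [vshift_vshift]
    by_cases h : vshift (-j + k) z ∈ thicken C
    · have := hz (-j + k) hzΩ (by push_cast; exact h)
      push_cast at this
      simp only [hF, indicator_of_mem h, this, one_mul]
    · simp [hF, h]
  have hcz : cnt (vshift (-j) z) ≠ 0 := by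
    classical
    have : cnt (vshift (-j) z) =
        ((∑ k ∈ s, if vshift k (vshift (-j) z) ∈ thicken C then 1 else 0 : ℕ) : ℂ) := by
      push_cast
      simp [hcnt, indicator_apply]
    rw [this, Nat.cast_ne_zero]
    refine (Finset.sum_pos' (fun _ _ => Nat.zero_le _) ⟨j, hjs, ?_⟩).ne'
    rw [vshift_vshift, neg_add_cancel, vshift_zero, if_pos hzΩ]
    exact one_pos
  change H (R (toCircleProd z)) = f z
  rw [hRz]
  simp only [hH, hval, ← Finset.sum_mul]
  rw [← mul_assoc, inv_mul_cancel₀ hcz, one_mul]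

/-- Systems on `C` and on its projection combine to a system on `thicken C`. -/
theorem IsRiesz.thicken {C : Set (X × ℝ)} (hC : VerticallyConvex C)
    (hCm : MeasurableSet C) (hΩ : MeasurableSet (thicken C))
    (hP : MeasurableSet (Prod.fst '' C)) (hPfin : ν (Prod.fst '' C) ≠ ∞) {N : ℕ}
    (hN : _root_.thicken C ⊆ (Prod.fst '' C) ×ˢ Ioc (-N : ℝ) N)
    {g : ι → X × ℝ → ℂ} (hg : IsRiesz ((ν.prod volume).restrict C) g)
    (hgΩ : IsBessel ((ν.prod volume).restrict (_root_.thicken C)) g)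
    {s : ι → ℂ} {σ K : ℝ≥0} (hσ : 0 < σ) (hs : ∀ i, σ ≤ ‖s i‖) (hsK : ∀ i, ‖s i‖ ≤ K)
    (hgs : ∀ i z, g i (vshift (-(1 / 2)) z) - g i (vshift (1 / 2) z) = s i * g i z)
    {p : κ → X → ℂ} (hp : IsRiesz (ν.restrict (Prod.fst '' C)) p) :
    IsRiesz ((ν.prod volume).restrict (_root_.thicken C))
      (Sum.elim g fun (q : κ × ℤ) z => fourier q.2 (z.2 : AddCircle (1 : ℝ)) * p q.1 z.1) := by
  set μ := (ν.prod volume : Measure (X × ℝ))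
  set P := Prod.fst '' C
  have : IsFiniteMeasure (ν.restrict P) := isFiniteMeasure_restrict.2 hPfin
  obtain ⟨TC, hTC⟩ := hg
  obtain ⟨T', hT'⟩ := hgΩ
  obtain ⟨Q, hQ⟩ := hp.prod_fourier
  have hneg : (-(1 / 2) : ℝ) ∈ Icc (-(1 / 2) : ℝ) (1 / 2) := by norm_num
  have hpos : (1 / 2 : ℝ) ∈ Icc (-(1 / 2) : ℝ) (1 / 2) := by norm_num
  have q1 := quasiMeasurePreserving_of_map_le (measurable_vshift _)
    (map_vshift_restrict_le (ν := ν) (C := C) hneg)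
  have q2 := quasiMeasurePreserving_of_map_le (measurable_vshift _)
    (map_vshift_restrict_le (ν := ν) (C := C) hpos)
  have q3 := quasiMeasurePreserving_of_map_le measurable_toCircleProd
    (map_toCircleProd_restrict_le (ν := ν) hN)
  obtain ⟨D₁, hD₁⟩ := exists_pullback (measurable_vshift _) (by simp)
    (map_vshift_restrict_le (ν := ν) (C := C) hneg)
  obtain ⟨D₂, hD₂⟩ := exists_pullback (measurable_vshift _) (by simp)
    (map_vshift_restrict_le (ν := ν) (C := C) hpos)
  obtain ⟨E, hE⟩ := exists_pullback measurable_toCircleProd (ENNReal.natCast_ne_top _)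
    (map_toCircleProd_restrict_le (ν := ν) hN)
  obtain ⟨S, -, hS⟩ := exists_diag s K hsK
  obtain ⟨S', -, hS'⟩ := exists_diag (fun i => (s i)⁻¹) σ⁻¹ (fun i => by
    rw [norm_inv, NNReal.coe_inv]
    exact inv_anti₀ (by exact_mod_cast hσ) (hs i))
  have hs0 : ∀ i, s i ≠ 0 := fun i h => by
    have := hs i
    rw [h, norm_zero] at this
    have h2 : (0 : ℝ) < σ := by exact_mod_cast hσ
    linarith
  have hSS' : S ∘L S' = ContinuousLinearMap.id ℂ _ :=
    clm_ext fun i => by simp [hS, hS', smul_smul, hs0 i]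
  have hS'S : S' ∘L S = ContinuousLinearMap.id ℂ _ :=
    clm_ext fun i => by simp [hS, hS', smul_smul, hs0 i]
  have hDf : ∀ f, (D₁ - D₂) f =ᵐ[μ.restrict C]
      fun z => f (vshift (-(1 / 2)) z) - f (vshift (1 / 2) z) := fun f => by
    filter_upwards [hD₁ f, hD₂ f, Lp.coeFn_sub (D₁ f) (D₂ f)] with z h1 h2 h3
    change (D₁ f - D₂ f) z = _
    rw [h3, Pi.sub_apply, h1, h2]; rfl
  -- The intertwining relation: on exponential-type systems the difference operator becomes the
  -- invertible diagonal operator S.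
  have hDT : (D₁ - D₂) ∘L T' = TC.toContinuousLinearMap ∘L S := clm_ext fun i => by
    change (D₁ - D₂) (T' (delta i)) = TC (S (delta i))
    rw [hS, map_smul]
    apply Lp.ext
    filter_upwards [hDf (T' (delta i)), q1.ae_eq_comp (hT' i), q2.ae_eq_comp (hT' i),
      Lp.coeFn_smul (s i) (TC (delta i)), hTC i] with z h1 h2 h3 h4 h5
    simp only [Function.comp] at h2 h3
    rw [h1, h2, h3, h4, Pi.smul_apply, h5, hgs, smul_eq_mul]
  have hDE : ∀ h, (D₁ - D₂) (E h) = 0 := fun h => by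
    apply Lp.ext
    filter_upwards [hDf (E h), q1.ae_eq_comp (hE h), q2.ae_eq_comp (hE h),
      Lp.coeFn_zero ℂ 2 (μ.restrict C)] with z h1 h2 h3 h4
    simp only [Function.comp] at h2 h3
    rw [h1, h2, h3, h4]
    have : vshift (1 / 2) z = vshift ((1 : ℤ) : ℝ) (vshift (-(1 / 2)) z) := by
      rw [vshift_vshift]; norm_num
    rw [this, toCircleProd_vshift_intCast, sub_self]; rfl
  have hEinj : ∀ h, E h = 0 → h = 0 := fun h hh => by
    apply Lp.ext
    refine EventuallyEq.trans ?_ (Lp.coeFn_zero _ _ _).symm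
    refine ae_eq_zero_of_comp_toCircleProd hΩ hP (Lp.stronglyMeasurable h).measurable ?_
    refine (hE h).symm.trans ?_
    rw [hh]
    exact Lp.coeFn_zero _ _ _
  have hker : ∀ f, (D₁ - D₂) f = 0 → ∃ h, E h = f := fun f hf => by
    have h1 := hDf f
    rw [hf] at h1
    have h2 : ∀ᵐ z ∂μ, z ∈ C → f (vshift (-(1 / 2)) z) = f (vshift (1 / 2) z) := by
      rw [← ae_restrict_iff' hCm]
      filter_upwards [h1, Lp.coeFn_zero ℂ 2 (μ.restrict C)] with z e1 e2
      rw [e2] at e1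
      exact (sub_eq_zero.1 e1.symm)
    obtain ⟨h, hh⟩ := exists_comp_toCircleProd_eq hC hΩ hN f h2
    exact ⟨h, Lp.ext ((hE h).trans hh)⟩
  obtain ⟨Rl, hRl, hRl0⟩ := exists_restrict (Sum.inl : ι → ι ⊕ (κ × ℤ)) Sum.inl_injective
  obtain ⟨Rr, hRr, hRr0⟩ := exists_restrict (Sum.inr : κ × ℤ → ι ⊕ (κ × ℤ)) Sum.inr_injective
  obtain ⟨Jl, hJl⟩ := exists_extend (Sum.inl : ι → ι ⊕ (κ × ℤ)) Sum.inl_injective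
  obtain ⟨Jr, hJr⟩ := exists_extend (Sum.inr : κ × ℤ → ι ⊕ (κ × ℤ)) Sum.inr_injective
  have hRlr : ∀ q, Rl (delta (Sum.inr q)) = 0 := fun q => hRl0 _ (by simp)
  have hRrl : ∀ i, Rr (delta (Sum.inl i)) = 0 := fun i => hRr0 _ (by simp)
  have hJR : Jl ∘L Rl + Jr ∘L Rr = ContinuousLinearMap.id ℂ _ := clm_ext fun a => by
    rcases a with i | q
    · simp [hRl, hRrl, hJl]
    · simp [hRlr, hRr, hJr]
  have hll : Rl ∘L Jl = ContinuousLinearMap.id ℂ _ := clm_ext fun i => by simp [hJl, hRl]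
  have hlr : Rl ∘L Jr = 0 := clm_ext fun i => by simp [hJr, hRlr]
  have hrl : Rr ∘L Jl = 0 := clm_ext fun i => by simp [hJl, hRrl]
  have hrr : Rr ∘L Jr = ContinuousLinearMap.id ℂ _ := clm_ext fun i => by simp [hJr, hRr]
  refine IsRiesz.of_bijective (T' ∘L Rl + E ∘L Q.toContinuousLinearMap ∘L Rr) ?_ ?_ ?_
  · rintro (i | q)
    · simpa [hRl, hRrl] using hT' i
    · simp only [add_apply, ContinuousLinearMap.comp_apply, hRlr, hRr,
        map_zero, zero_add, Sum.elim_inr]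
      exact (hE _).trans (q3.ae_eq_comp (hQ q))
  · intro x hx
    replace hx : T' (Rl x) + E (Q (Rr x)) = 0 := hx
    have h1 := congrArg (D₁ - D₂) hx
    rw [map_add, hDE, add_zero, map_zero] at h1
    have h2 : TC (S (Rl x)) = 0 := (DFunLike.congr_fun hDT (Rl x)).symm.trans h1
    have h3 : S (Rl x) = 0 := by simpa using h2
    have h4 : Rl x = 0 := by
      have := DFunLike.congr_fun hS'S (Rl x)
      simp only [ContinuousLinearMap.comp_apply, h3, map_zero] at this
      exact this.symm
    rw [h4, map_zero, zero_add] at hx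
    have h5 : Rr x = 0 := by simpa using hEinj _ hx
    have := DFunLike.congr_fun hJR x
    simp only [add_apply, ContinuousLinearMap.comp_apply, h4, h5, map_zero,
      add_zero] at this
    exact this.symm
  · intro y
    -- The coefficients a solve D(T'a) = Dy, so y - T'a lies in ker D and is therefore periodic.
    set a := S' (TC.symm ((D₁ - D₂) y)) with ha
    have h1 : (D₁ - D₂) (y - T' a) = 0 := by
      rw [map_sub, sub_eq_zero]
      have h2 : (D₁ - D₂) (T' a) = TC (S a) := DFunLike.congr_fun hDT a
      have h3 : S a = TC.symm ((D₁ - D₂) y) := DFunLike.congr_fun hSS' _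
      rw [h2, h3, ContinuousLinearEquiv.apply_symm_apply]
    obtain ⟨h, hh⟩ := hker _ h1
    refine ⟨Jl a + Jr (Q.symm h), ?_⟩
    have e1 : Rl (Jl a + Jr (Q.symm h)) = a := by
      rw [map_add, show Rl (Jl a) = a from DFunLike.congr_fun hll a,
        show Rl (Jr (Q.symm h)) = 0 from DFunLike.congr_fun hlr _, add_zero]
    have e2 : Rr (Jl a + Jr (Q.symm h)) = Q.symm h := by
      rw [map_add, show Rr (Jr (Q.symm h)) = Q.symm h from DFunLike.congr_fun hrr _,
        show Rr (Jl a) = 0 from DFunLike.congr_fun hrl _, zero_add]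
    change T' (Rl _) + E (Q (Rr _)) = y
    rw [e1, e2, ContinuousLinearEquiv.apply_symm_apply, hh]
    abel

theorem IsBessel.sumElim {Y κ' : Type*} [MeasurableSpace Y] {m : Measure Y} {g : ι → Y → ℂ}
    {g' : κ' → Y → ℂ} (hg : IsBessel m g) (hg' : IsBessel m g') :
    IsBessel m (Sum.elim g g') := by
  obtain ⟨T, hT⟩ := hg
  obtain ⟨T', hT'⟩ := hg'
  obtain ⟨Rl, hRl, hRl0⟩ := exists_restrict (Sum.inl : ι → ι ⊕ κ') Sum.inl_injective
  obtain ⟨Rr, hRr, hRr0⟩ := exists_restrict (Sum.inr : κ' → ι ⊕ κ') Sum.inr_injective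
  refine ⟨T ∘L Rl + T' ∘L Rr, ?_⟩
  rintro (i | q)
  · simpa [hRl, hRr0 (Sum.inl i) (by simp)] using hT i
  · simpa [hRr, hRl0 (Sum.inr q) (by simp)] using hT' q

/-- Unlike the Riesz property, this needs only boundedness of `B`; it propagates the Bessel bound on
balls through the induction. -/
theorem IsBessel.periodic {B : Set (X × ℝ)} {P : Set X} (hP : ν P ≠ ∞) {N : ℕ}
    (hB : B ⊆ P ×ˢ Ioc (-N : ℝ) N) {p : κ → X → ℂ} (hp : IsBessel (ν.restrict P) p) :
    IsBessel ((ν.prod volume).restrict B)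
      fun (q : κ × ℤ) z => fourier q.2 (z.2 : AddCircle (1 : ℝ)) * p q.1 z.1 := by
  have : IsFiniteMeasure (ν.restrict P) := isFiniteMeasure_restrict.2 hP
  have h := IsBessel.comp (φ := toCircleProd) hp.prod_fourier measurable_toCircleProd
    (ENNReal.natCast_ne_top _) (map_toCircleProd_restrict_le (ν := ν) hB)
  exact h.congr fun q => ae_of_all _ fun z => rfl

end Thickening

/-! ### Exponential systems and the inductive step -/

section Exponentials

open SeqL2 AddCircle

/-- The exponential function with frequency in the dual space. -/
def dualExp {E : Type*} [NormedAddCommGroup E] [NormedSpace ℝ E] (l : E →L[ℝ] ℝ) (x : E) : ℂ :=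
  Complex.exp (2 * Real.pi * Complex.I * (l x : ℝ))

/-- There is a Riesz basis of exponentials on `S` which is Bessel on every ball. -/
def HasExpRieszBasis {E : Type*} [NormedAddCommGroup E] [NormedSpace ℝ E] [MeasurableSpace E]
    (μ : Measure E) (S : Set E) : Prop :=
  ∃ (ι : Type) (l : ι → E →L[ℝ] ℝ), IsRiesz (μ.restrict S) (fun i => dualExp (l i)) ∧
    ∀ R : ℝ, IsBessel (μ.restrict (Metric.closedBall 0 R)) fun i => dualExp (l i)

/-- Jordan's inequality after reduction modulo the period π of |sin|. -/
theorem two_mul_le_abs_sin_pi_mul {x η : ℝ} (h : η ≤ |x - round x|) :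
    2 * η ≤ |Real.sin (Real.pi * x)| := by
  have hπ := Real.pi_pos
  have h1 : |Real.pi * (x - round x)| ≤ Real.pi / 2 := by
    rw [abs_mul, abs_of_pos hπ]
    nlinarith [abs_sub_round x]
  have h2 := Real.mul_abs_le_abs_sin h1
  have h3 : |Real.sin (Real.pi * (x - round x))| = |Real.sin (Real.pi * x)| := by
    rw [show Real.pi * (x - round x) = Real.pi * x - (round x : ℤ) * Real.pi by ring,
      Real.sin_sub_int_mul_pi, abs_mul]
    simp
  rw [← h3]
  refine le_trans ?_ h2
  rw [abs_mul, abs_of_pos hπ, ← mul_assoc, div_mul_cancel₀ _ hπ.ne']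
  linarith

/-- A shift by δ leaves the δ/4-neighbourhood of the nearest integer, and δ ≤ 1/2 is too short to
come near the next one. -/
theorem le_abs_add_sub_round {x δ : ℝ} (hδ : 0 < δ) (hδ' : δ ≤ 1 / 2)
    (h : |x - round x| < δ / 4) : δ / 4 ≤ |x + δ - round (x + δ)| := by
  obtain ⟨h1, h2⟩ := abs_lt.1 h
  set m := round x
  set k := round (x + δ)
  rcases lt_trichotomy k m with hk | hk | hk
  · have : (k : ℝ) + 1 ≤ m := by exact_mod_cast hk
    exact le_trans (by linarith) (le_abs_self _)
  · have : (k : ℝ) = m := by exact_mod_cast hk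
    exact le_trans (by linarith) (le_abs_self _)
  · have : (m : ℝ) + 1 ≤ k := by exact_mod_cast hk
    exact le_trans (by linarith) (neg_le_abs _)

theorem exists_nat_subset_prod_Ioc {F : Type*} [NormedAddCommGroup F] {B : Set (F × ℝ)} (hB : Bornology.IsBounded B) {P : Set F}
    (hP : Prod.fst '' B ⊆ P) : ∃ N : ℕ, B ⊆ P ×ˢ Ioc (-N : ℝ) N := by
  obtain ⟨R, hR⟩ := hB.subset_closedBall 0
  obtain ⟨N, hN⟩ := exists_nat_gt R
  refine ⟨N, fun z hz => ⟨hP ⟨z, hz, rfl⟩, ?_⟩⟩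
  have h1 : ‖z‖ ≤ R := by simpa using hR hz
  have h2 : |z.2| ≤ R := (norm_snd_le z).trans h1
  obtain ⟨h3, h4⟩ := abs_le.1 h2
  exact ⟨by linarith, by linarith⟩

theorem isCompact_thicken {F : Type*} [NormedAddCommGroup F] {C : Set (F × ℝ)} (hC : IsCompact C) : IsCompact (thicken C) := by
  have h : thicken C = (fun q : ℝ × (F × ℝ) => vshift q.1 q.2) ''
      (Icc (-(1 / 2) : ℝ) (1 / 2) ×ˢ C) := by
    ext z
    constructor
    · rintro ⟨s, hs, hz⟩
      exact ⟨(s, vshift (-s) z), ⟨hs, hz⟩, by simp [vshift_vshift, vshift_zero]⟩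
    · rintro ⟨⟨s, z⟩, ⟨hs, hz⟩, rfl⟩
      exact vshift_mem_thicken hz hs
  rw [h]
  refine (isCompact_Icc.prod hC).image ?_
  unfold vshift
  fun_prop

theorem fst_image_thicken_subset {X : Type*} {C : Set (X × ℝ)} : Prod.fst '' thicken C ⊆ Prod.fst '' C := by
  rintro _ ⟨z, ⟨s, -, hz⟩, rfl⟩
  exact ⟨_, hz, rfl⟩

section

variable {E : Type*} [NormedAddCommGroup E] [NormedSpace ℝ E]

theorem dualExp_add (l l' : E →L[ℝ] ℝ) (x : E) :
    dualExp (l + l') x = dualExp l x * dualExp l' x := by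
  rw [dualExp, dualExp, dualExp, ← Complex.exp_add]
  congr 1
  simp only [add_apply]; push_cast; ring

theorem dualExp_zero (x : E) : dualExp 0 x = 1 := by simp [dualExp]

theorem continuous_dualExp (l : E →L[ℝ] ℝ) : Continuous (dualExp l) := by
  unfold dualExp; fun_prop

theorem norm_dualExp (l : E →L[ℝ] ℝ) (x : E) : ‖dualExp l x‖ = 1 := by
  rw [dualExp, show 2 * Real.pi * Complex.I * (l x : ℝ) = ((2 * Real.pi * l x : ℝ) : ℂ) * Complex.I
    by push_cast; ring]
  exact Complex.norm_exp_ofReal_mul_I _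

theorem norm_dualExp_sub_one_le (l : E →L[ℝ] ℝ) (x : E) :
    ‖dualExp l x - 1‖ ≤ 2 * Real.pi * |l x| := by
  rw [dualExp, show 2 * Real.pi * Complex.I * (l x : ℝ) = Complex.I * ((2 * Real.pi * l x : ℝ) : ℂ)
    by push_cast; ring]
  refine Real.norm_exp_I_mul_ofReal_sub_one_le.trans ?_
  rw [Real.norm_eq_abs, abs_mul, abs_of_pos Real.two_pi_pos]

end

variable {F : Type*} [NormedAddCommGroup F] [NormedSpace ℝ F]

theorem dualExp_vshift_sub (l : F × ℝ →L[ℝ] ℝ) (z : F × ℝ) :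
    dualExp l (vshift (-(1 / 2)) z) - dualExp l (vshift (1 / 2) z) =
      (-(2 * Complex.I) * Real.sin (Real.pi * l (0, 1)) : ℂ) * dualExp l z := by
  have h : ∀ a : ℝ, dualExp l (vshift a z) =
      Complex.exp ((2 * a * (Real.pi * l (0, 1) : ℝ) : ℂ) * Complex.I) * dualExp l z := by
    intro a
    have : vshift a z = z + a • (0, 1) := by ext <;> simp [vshift]
    rw [this, dualExp, dualExp, ← Complex.exp_add, map_add, map_smul]
    congr 1
    push_cast [smul_eq_mul]; ring
  rw [h, h, Complex.ofReal_sin, Complex.sin]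
  push_cast
  ring_nf
  rw [Complex.I_sq]
  ring

theorem fourier_mul_dualExp (k : ℤ) (l : F →L[ℝ] ℝ) (z : F × ℝ) :
    fourier k (z.2 : AddCircle (1 : ℝ)) * dualExp l z.1 =
      dualExp (l ∘L ContinuousLinearMap.fst ℝ F ℝ + (k : ℝ) • ContinuousLinearMap.snd ℝ F ℝ) z := by
  rw [fourier_coe_apply, dualExp, dualExp, ← Complex.exp_add]
  congr 1
  simp
  ring

theorem Convex.verticallyConvex {C : Set (F × ℝ)} (hC : Convex ℝ C) : VerticallyConvex C := by
  intro x s t r hs ht hsr hrt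
  have hsub : segment ℝ (x, s) (x, t) ⊆ C := hC.segment_subset hs ht
  rcases hsr.eq_or_lt with h | h
  · rwa [← h]
  have hst : 0 < t - s := by linarith
  refine hsub ⟨(t - r) / (t - s), (r - s) / (t - s), by apply div_nonneg <;> linarith,
    by apply div_nonneg <;> linarith, by field_simp; ring, ?_⟩
  ext
  · simp only [Prod.smul_mk, Prod.mk_add_mk, ← add_smul]
    rw [show (t - r) / (t - s) + (r - s) / (t - s) = 1 by field_simp; ring, one_smul]
  · simp only [Prod.smul_mk, Prod.mk_add_mk, smul_eq_mul]
    field_simp; ring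

variable [MeasurableSpace F] [BorelSpace F] [FiniteDimensional ℝ F]

/-- The frequencies on `C` are first moved off the integers in the vertical direction; then
`IsRiesz.thicken` applies, and by `fourier_mul_dualExp` the periodic part again consists of
exponentials. -/
theorem HasExpRieszBasis.thicken {ν : Measure F} [ν.IsAddHaarMeasure] {C : Set (F × ℝ)}
    (hC : IsCompact C) (hconv : Convex ℝ C) (hCR : HasExpRieszBasis (ν.prod volume) C)
    (hPR : HasExpRieszBasis ν (Prod.fst '' C)) :
    HasExpRieszBasis (ν.prod volume) (_root_.thicken C) := by
  obtain ⟨ι, l, hlR, hlB⟩ := hCR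
  obtain ⟨κ, p, hpR, hpB⟩ := hPR
  have hΩ := isCompact_thicken hC
  have hP : IsCompact (Prod.fst '' C) := hC.image continuous_fst
  obtain ⟨N, hN⟩ := exists_nat_subset_prod_Ioc hΩ.isBounded fst_image_thicken_subset
  obtain ⟨M, hM⟩ := exists_nat_subset_prod_Ioc hC.isBounded subset_rfl
  obtain ⟨ε, hε, hpert⟩ := hlR.perturb
  -- On `C` heights are at most M, so multiplication by the exponential of δt differs from 1 by at
  -- most 2πδM ≤ ε. The summand 1 avoids division by zero.
  set δ : ℝ := min (1 / 2) (ε / (2 * Real.pi * (M + 1))) with hδdef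
  have hπ := Real.pi_pos
  have hε' : (0 : ℝ) < ε := by exact_mod_cast hε
  have hδ : 0 < δ := by positivity
  have hδ' : δ ≤ 1 / 2 := min_le_left _ _
  have hδε : 2 * Real.pi * (δ * M) ≤ ε := by
    have h1 : δ ≤ ε / (2 * Real.pi * (M + 1)) := min_le_right _ _
    rw [le_div_iff₀ (by positivity)] at h1
    nlinarith
  -- Only frequencies close to an integer are moved; moving all of them could push others onto
  -- integers.
  set A : Set ι := {i | |l i (0, 1) - round (l i (0, 1))| < δ / 4}
  set v : F × ℝ →L[ℝ] ℝ := δ • ContinuousLinearMap.snd ℝ F ℝ with hv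
  set l' : ι → F × ℝ →L[ℝ] ℝ := fun i => l i + A.indicator (fun _ => v) i with hl'
  have hl'exp : ∀ i z, (A.indicator (fun _ => dualExp v z) i + Aᶜ.indicator (fun _ => 1) i) *
      dualExp (l i) z = dualExp (l' i) z := fun i z => by
    rw [hl', dualExp_add, mul_comm]
    by_cases h : i ∈ A <;> simp [h, dualExp_zero]
  have hvm : Measurable (dualExp v) := (continuous_dualExp v).measurable
  have hR' : IsRiesz ((ν.prod volume).restrict C) fun i => dualExp (l' i) := by
    refine (hpert A (dualExp v) hvm ?_).congr fun i => ae_of_all _ (hl'exp i)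
    refine (ae_restrict_iff' hC.measurableSet).2 (ae_of_all _ fun z hz => ?_)
    refine (norm_dualExp_sub_one_le v z).trans (le_trans ?_ hδε)
    have h1 := (hM hz).2
    have h2 : |z.2| ≤ M := abs_le.2 ⟨h1.1.le, h1.2⟩
    have h3 : |v z| = δ * |z.2| := by simp [hv, abs_mul, abs_of_pos hδ]
    rw [h3]
    gcongr
  have hB' : ∀ R : ℝ, IsBessel ((ν.prod volume).restrict (Metric.closedBall 0 R))
      fun i => dualExp (l' i) := fun R =>
    ((hlB R).perturb A hvm fun z => (norm_dualExp v z).le).congr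
      fun i => ae_of_all _ (hl'exp i)
  have hτ : ∀ i, δ / 4 ≤ |l' i (0, 1) - round (l' i (0, 1))| := fun i => by
    by_cases h : i ∈ A
    · have : l' i (0, 1) = l i (0, 1) + δ := by simp [hl', h, hv]
      rw [this]
      exact le_abs_add_sub_round hδ hδ' h
    · have : l' i (0, 1) = l i (0, 1) := by simp [hl', h]
      rw [this]
      exact not_lt.1 h
  have hΩB : IsBessel ((ν.prod volume).restrict (_root_.thicken C)) fun i => dualExp (l' i) := by
    obtain ⟨R, hR⟩ := hΩ.isBounded.subset_closedBall 0
    exact (hB' R).mono_measure (Measure.restrict_mono hR le_rfl)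
  have hsn : ∀ i, ‖(-(2 * Complex.I) * Real.sin (Real.pi * l' i (0, 1)) : ℂ)‖ =
      2 * |Real.sin (Real.pi * l' i (0, 1))| := fun i => by
    rw [norm_mul, norm_neg, norm_mul, Complex.norm_I, Complex.norm_real, Real.norm_eq_abs]
    simp
  -- The distance δ/4 to the integers gives 2|sin| ≥ 2 · 2 · δ/4 = δ, hence the lower bound σ = δ.
  have hfin := IsRiesz.thicken (ν := ν) hconv.verticallyConvex hC.measurableSet hΩ.measurableSet
    hP.measurableSet hP.measure_ne_top hN hR' hΩB (σ := ⟨δ, hδ.le⟩) (K := 2) (by exact_mod_cast hδ)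
    (fun i => by
      rw [hsn]
      have := two_mul_le_abs_sin_pi_mul (hτ i)
      change δ ≤ _
      linarith)
    (fun i => by
      rw [hsn]
      have := Real.abs_sin_le_one (Real.pi * l' i (0, 1))
      norm_num
      linarith)
    (fun i z => dualExp_vshift_sub (l' i) z) hpR
  refine ⟨ι ⊕ κ × ℤ, Sum.elim l' fun q => p q.1 ∘L ContinuousLinearMap.fst ℝ F ℝ +
    (q.2 : ℝ) • ContinuousLinearMap.snd ℝ F ℝ, hfin.congr ?_, fun R => ?_⟩
  · rintro (i | q)
    · rfl
    · exact ae_of_all _ fun z => fourier_mul_dualExp q.2 (p q.1) z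
  · obtain ⟨K, hK⟩ := exists_nat_subset_prod_Ioc (B := Metric.closedBall (0 : F × ℝ) R)
      Metric.isBounded_closedBall (P := Metric.closedBall 0 R) (by
        rintro _ ⟨z, hz, rfl⟩
        simp only [mem_closedBall_zero_iff] at hz ⊢
        exact (norm_fst_le z).trans hz)
    refine ((hB' R).sumElim (IsBessel.periodic measure_closedBall_lt_top.ne hK (hpB R))).congr ?_
    rintro (i | q)
    · rfl
    · exact ae_of_all _ fun z => fourier_mul_dualExp q.2 (p q.1) z

end Exponentials

/-! ### Zonotopes, the induction, and the return to Euclidean space -/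

section Zonotopes

open SeqL2

/-- The zonotope generated by the vectors `u j` of a real vector space. -/
def zonotopeOf {E : Type*} [AddCommGroup E] [Module ℝ E] {n : ℕ} (u : Fin n → E) : Set E :=
  {x | ∃ t : Fin n → ℝ, (∀ j, t j ∈ Icc (-(1 / 2) : ℝ) (1 / 2)) ∧ x = ∑ j, t j • u j}

theorem zonotopeOf_eq_image {E : Type*} [AddCommGroup E] [Module ℝ E] {n : ℕ} (u : Fin n → E) :
    zonotopeOf u = Fintype.linearCombination ℝ u ''
      univ.pi fun _ => Icc (-(1 / 2) : ℝ) (1 / 2) := by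
  ext x
  simp only [zonotopeOf, mem_ofPred_eq, mem_image, mem_univ_pi, Fintype.linearCombination_apply,
    eq_comm]

theorem image_zonotopeOf {E E' : Type*} [AddCommGroup E] [Module ℝ E] [AddCommGroup E']
    [Module ℝ E'] {n : ℕ} (u : Fin n → E) (L : E →ₗ[ℝ] E') :
    L '' zonotopeOf u = zonotopeOf fun j => L (u j) := by
  ext x
  constructor
  · rintro ⟨_, ⟨t, ht, rfl⟩, rfl⟩
    exact ⟨t, ht, by simp⟩
  · rintro ⟨t, ht, rfl⟩
    exact ⟨_, ⟨t, ht, rfl⟩, by simp⟩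

theorem mem_zonotopeOf_succ {E : Type*} [AddCommGroup E] [Module ℝ E] {n : ℕ}
    (u : Fin (n + 1) → E) (x : E) : x ∈ zonotopeOf u ↔
      ∃ s ∈ Icc (-(1 / 2) : ℝ) (1 / 2),
        x + (-s) • u (Fin.last n) ∈ zonotopeOf fun j => u (Fin.castSucc j) := by
  constructor
  · rintro ⟨t, ht, rfl⟩
    exact ⟨t (Fin.last n), ht _, fun j => t (Fin.castSucc j), fun j => ht _, by
      rw [Fin.sum_univ_castSucc]; simp⟩
  · rintro ⟨s, hs, t, ht, hx⟩
    refine ⟨Fin.snoc t s, fun j => ?_, ?_⟩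
    · refine Fin.lastCases ?_ (fun j => ?_) j
      · simpa using hs
      · simpa using ht j
    · rw [Fin.sum_univ_castSucc]
      simp [← hx]

theorem zonotopeOf_eq_thicken {F : Type*} [AddCommGroup F] [Module ℝ F] {n : ℕ}
    {u : Fin (n + 1) → F × ℝ} (hu : u (Fin.last n) = (0, 1)) :
    zonotopeOf u = thicken (zonotopeOf fun j => u (Fin.castSucc j)) := by
  ext z
  rw [mem_zonotopeOf_succ, hu]
  have : ∀ s : ℝ, z + (-s) • ((0 : F), (1 : ℝ)) = vshift (-s) z := fun s => by
    ext <;> simp [vshift]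
  simp only [this]
  rfl

theorem zonotopeOf_of_last_eq_zero {E : Type*} [AddCommGroup E] [Module ℝ E] {n : ℕ}
    {u : Fin (n + 1) → E} (hu : u (Fin.last n) = 0) :
    zonotopeOf u = zonotopeOf fun j => u (Fin.castSucc j) := by
  ext x
  rw [mem_zonotopeOf_succ, hu]
  simp only [smul_zero, add_zero]
  exact ⟨fun ⟨_, _, h⟩ => h, fun h => ⟨0, by norm_num, h⟩⟩

theorem convex_zonotopeOf {E : Type*} [AddCommGroup E] [Module ℝ E] {n : ℕ} (u : Fin n → E) :
    Convex ℝ (zonotopeOf u) := by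
  rw [zonotopeOf_eq_image]
  exact (convex_pi fun _ _ => convex_Icc _ _).linear_image _

theorem isCompact_zonotopeOf {E : Type*} [NormedAddCommGroup E] [NormedSpace ℝ E] {n : ℕ}
    (u : Fin n → E) : IsCompact (zonotopeOf u) := by
  rw [zonotopeOf_eq_image]
  exact (isCompact_univ_pi fun _ => isCompact_Icc).image
    (LinearMap.continuous_of_finiteDimensional _)

theorem isRiesz_one_of_subsingleton {E : Type*} [MeasurableSpace E]
    [Subsingleton E] [Zero E] (μ : Measure E) [IsFiniteMeasure μ]
    (hμ : μ ≠ 0) : IsRiesz μ fun (_ : Unit) (_ : E) => (1 : ℂ) := by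
  have hm : MemLp (fun _ : E => (1 : ℂ)) 2 μ := memLp_const _
  set c := hm.toLp with hc
  have hc1 : c =ᵐ[μ] fun _ => 1 := hm.coeFn_toLp
  have hd := orthonormal_iff_ite.1 (orthonormal_delta (ι := Unit))
  have hμ' : NeBot (ae μ) := ae_neBot.2 hμ
  have hc0 : c ≠ 0 := fun h => by
    rw [h] at hc1
    obtain ⟨x, h1, h2⟩ := (hc1.and (Lp.coeFn_zero ℂ 2 μ)).exists
    rw [h1] at h2
    exact one_ne_zero h2
  refine IsRiesz.of_bijective ((innerSL ℂ (delta ())).smulRight c) (fun i => ?_) (fun x hx => ?_)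
    fun y => ⟨y 0 • delta (), ?_⟩
  · change (inner ℂ (delta ()) (delta i) • c : Lp ℂ 2 μ) =ᵐ[μ] _
    rw [hd, if_pos rfl, one_smul]
    exact hc1
  · refine eq_of_inner_delta fun i => ?_
    have h1 : inner ℂ (delta ()) x • c = 0 := hx
    simpa using (smul_eq_zero.1 h1).resolve_right hc0
  · have : ((innerSL ℂ (delta ())).smulRight c) (y 0 • delta ()) = y 0 • c := by
      change inner ℂ (delta ()) (y 0 • delta ()) • c = _
      rw [inner_smul_right, hd]; simp
    rw [this]
    apply Lp.ext
    filter_upwards [Lp.coeFn_smul (y 0) c, hc1] with x h1 h2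
    rw [h1, Pi.smul_apply, h2, Subsingleton.elim x 0]; simp

section

variable {E : Type*} [NormedAddCommGroup E] [NormedSpace ℝ E] [MeasurableSpace E] [BorelSpace E]

theorem HasExpRieszBasis.of_equiv {E' : Type*} [NormedAddCommGroup E'] [NormedSpace ℝ E']
    [MeasurableSpace E'] [BorelSpace E'] (e : E ≃L[ℝ] E') {μ : Measure E} {S : Set E}
    (hS : MeasurableSet (e '' S)) (h : HasExpRieszBasis (μ.map e) (e '' S)) :
    HasExpRieszBasis μ S := by
  obtain ⟨ι, l, hR, hB⟩ := h
  refine ⟨ι, fun i => l i ∘L e.toContinuousLinearMap, ?_, fun R => ?_⟩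
  · refine (hR.comp_equiv (m := μ.restrict S) e.toHomeomorph.toMeasurableEquiv ?_).congr
      fun i => ae_of_all _ fun z => rfl
    change (μ.restrict S).map e = _
    rw [Measure.restrict_map e.continuous.measurable hS, e.injective.preimage_image]
  · have hsub : e '' Metric.closedBall 0 R ⊆
        Metric.closedBall 0 (‖e.toContinuousLinearMap‖ * R) := by
      rintro _ ⟨x, hx, rfl⟩
      rw [mem_closedBall_zero_iff] at hx ⊢
      exact (e.toContinuousLinearMap.le_opNorm x).trans (by gcongr)
    have hle : (μ.restrict (Metric.closedBall 0 R)).map e ≤ (1 : ℝ≥0∞) •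
        (μ.map e).restrict (Metric.closedBall 0 (‖e.toContinuousLinearMap‖ * R)) := by
      rw [one_smul, Measure.restrict_map e.continuous.measurable
        Metric.isClosed_closedBall.measurableSet]
      exact Measure.map_mono (Measure.restrict_mono (image_subset_iff.1 hsub) le_rfl)
        e.continuous.measurable
    exact (IsBessel.comp (φ := e) (hB _) e.continuous.measurable (by simp) hle).congr
      fun i => ae_of_all _ fun z => rfl

variable [FiniteDimensional ℝ E]

/-- In dimension zero the point has positive mass and the constant 1 is a basis. In positive
dimension it is a null set, L² is trivial, and the empty system serves. -/
theorem hasExpRieszBasis_singleton_zero (μ : Measure E) [μ.IsAddHaarMeasure] :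
    HasExpRieszBasis μ ({0} : Set E) := by
  rcases subsingleton_or_nontrivial E with hE | hE
  · have huniv : ({0} : Set E) = univ := Subsingleton.eq_univ_of_nonempty ⟨0, rfl⟩
    have hfin : IsFiniteMeasure μ := ⟨by
      rw [← huniv]; exact isCompact_singleton.measure_lt_top⟩
    have h : IsRiesz μ fun (_ : Unit) => dualExp (0 : E →L[ℝ] ℝ) :=
      (isRiesz_one_of_subsingleton μ (NeZero.ne μ)).congr
        fun i => ae_of_all _ fun z => (dualExp_zero z).symm
    refine ⟨Unit, fun _ => 0, ?_, fun R => h.isBessel.mono_measure Measure.restrict_le_self⟩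
    rwa [huniv, Measure.restrict_univ]
  · refine ⟨Empty, Empty.elim, ?_, fun R => ⟨0, fun i => i.elim⟩⟩
    have h0 : μ.restrict ({0} : Set E) = 0 := Measure.restrict_eq_zero.2 (measure_singleton 0)
    rw [h0]
    refine IsRiesz.of_bijective 0 (fun i => i.elim) (fun x _ => ?_) fun y => ⟨0, ?_⟩
    · exact eq_of_inner_delta fun i => i.elim
    · apply Lp.ext
      rw [Filter.EventuallyEq, ae_zero]
      exact eventually_bot

/-- A nonzero vector of `E` is the vertical unit vector in suitable coordinates. -/
theorem exists_equiv_prod {u : E} (hu : u ≠ 0) (μ : Measure E) [μ.IsAddHaarMeasure] :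
    ∃ (F : Submodule ℝ E) (e : E ≃L[ℝ] F × ℝ) (ν : Measure F),
      ν.IsAddHaarMeasure ∧ e u = (0, 1) ∧ μ.map e = ν.prod volume := by
  obtain ⟨φ, hφ⟩ := SeparatingDual.exists_eq_one (R := ℝ) hu
  have hinv : Function.RightInverse (ContinuousLinearMap.toSpanSingleton ℝ u) φ := fun x => by
    simp [hφ]
  let e₀ := ContinuousLinearEquiv.equivOfRightInverse φ (ContinuousLinearMap.toSpanSingleton ℝ u) hinv
  let e := e₀.trans (ContinuousLinearEquiv.prodComm ℝ ℝ φ.ker)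
  have hμ : (μ.map e).IsAddHaarMeasure := e.isAddHaarMeasure_map μ
  let ν : Measure φ.ker := Measure.addHaar
  have hs := Measure.isAddLeftInvariant_eq_smul (μ.map e) (ν.prod volume)
  have hpos := Measure.addHaarScalarFactor_pos_of_isAddHaarMeasure (μ.map e) (ν.prod volume)
  -- By uniqueness of Haar measure the two measures differ by a positive factor, which is absorbed
  -- into the measure on the kernel.
  refine ⟨φ.ker, e, (Measure.addHaarScalarFactor (μ.map e) (ν.prod volume) : ℝ≥0∞) • ν, ?_, ?_, ?_⟩
  · exact Measure.IsAddHaarMeasure.smul _ (by exact_mod_cast hpos.ne') (by simp)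
  · change ((e₀ u).2, (e₀ u).1) = _
    have h1 : (e₀ u).1 = 1 := by simp [e₀, hφ]
    have h2 : (e₀ u).2 = 0 := by
      ext
      simp [e₀, hφ]
    rw [h1, h2]
  · rw [Measure.prod_smul_left]
    exact hs

end

/-- Space and measure are quantified inside the induction, because the step uses the hypothesis both
in `F × ℝ` and in `F`. Families that do not span are included, since removing a generator may lose
spanning. -/
theorem hasExpRieszBasis_zonotopeOf (n : ℕ) : ∀ (E : Type) [NormedAddCommGroup E]
    [NormedSpace ℝ E] [MeasurableSpace E] [BorelSpace E] [FiniteDimensional ℝ E] (μ : Measure E)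
    [μ.IsAddHaarMeasure] (u : Fin n → E), HasExpRieszBasis μ (zonotopeOf u) := by
  induction n with
  | zero =>
    intro E _ _ _ _ _ μ _ u
    have : zonotopeOf u = {0} := by
      ext x; simp [zonotopeOf]
    rw [this]
    exact hasExpRieszBasis_singleton_zero μ
  | succ n ih =>
    intro E _ _ _ _ _ μ _ u
    by_cases hu : u (Fin.last n) = 0
    · rw [zonotopeOf_of_last_eq_zero hu]
      exact ih E μ _
    · obtain ⟨F, e, ν, hν, heu, hμ⟩ := exists_equiv_prod hu μ
      refine HasExpRieszBasis.of_equiv e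
        ((isCompact_zonotopeOf u).image e.continuous).measurableSet ?_
      have himg : e '' zonotopeOf u = zonotopeOf fun j => e (u j) :=
        image_zonotopeOf u e.toLinearEquiv.toLinearMap
      rw [hμ, himg, zonotopeOf_eq_thicken heu]
      refine HasExpRieszBasis.thicken (isCompact_zonotopeOf _) (convex_zonotopeOf _)
        (ih (F × ℝ) _ _) ?_
      have hfst : Prod.fst '' (zonotopeOf fun j : Fin n => e (u j.castSucc)) =
          zonotopeOf fun j : Fin n => (e (u j.castSucc)).1 :=
        image_zonotopeOf _ (LinearMap.fst ℝ F ℝ)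
      rw [hfst]
      exact ih F ν _

theorem IsRiesz.injective {X ι : Type*} [MeasurableSpace X] {m : Measure X} {g : ι → X → ℂ}
    (hg : IsRiesz m g) : Function.Injective g := by
  obtain ⟨T, hT⟩ := hg
  intro i j hij
  apply delta_injective
  apply T.injective
  apply Lp.ext
  filter_upwards [hT i, hT j] with x h1 h2
  rw [h1, h2, hij]

theorem HasExpRieszBasis.exists_isExpRieszBasis {d : ℕ} {S : Set (EuclideanSpace ℝ (Fin d))}
    (h : HasExpRieszBasis volume S) : ∃ L, IsExpRieszBasis S L := by
  obtain ⟨ι, l, hR, -⟩ := h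
  have hl : Function.Injective l := fun i j hij => hR.injective (by simp only [hij])
  obtain ⟨T, hT⟩ := hR
  let r : ι → EuclideanSpace ℝ (Fin d) := fun i => (InnerProductSpace.toDual ℝ _).symm (l i)
  have hr : Function.Injective r := (InnerProductSpace.toDual ℝ _).symm.injective.comp hl
  -- A Riesz system has no repeated members, so its frequencies are distinct and the index type can
  -- be replaced by the set of frequencies.
  let e : ι ≃ range r := Equiv.ofInjective r hr
  obtain ⟨J, hJ⟩ := exists_reindex e.symm
  refine ⟨range r, fun a => (J.trans T) (delta a), fun a => ?_, isRieszBasis_of_equiv (J.trans T)⟩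
  obtain ⟨i, rfl⟩ := e.surjective a
  have h1 : (J.trans T) (delta (e i)) = T (delta i) := by
    change T (J (delta (e i))) = _
    rw [hJ, Equiv.symm_apply_apply]
  beta_reduce
  rw [h1]
  refine (hT i).trans (ae_of_all _ fun x => ?_)
  change dualExp (l i) x = expFun (r i) x
  simp [dualExp, expFun, r]

end Zonotopes

end

theorem theorem5p1 (d n : ℕ) (u : Fin n → EuclideanSpace ℝ (Fin d))
    (hu : Submodule.span ℝ (Set.range u) = ⊤) :
    ∃ L : Set (EuclideanSpace ℝ (Fin d)), IsExpRieszBasis (zonotope u) L :=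
  (hasExpRieszBasis_zonotopeOf n _ MeasureTheory.volume u).exists_isExpRieszBasis
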